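/- Let $\mathbb D$ be the open unit disc in $\mathbb C$ and let $v(z)=1$ if $|z|\le 1-1/e$, $v(z)=(-\log(1-|z|))^{-1}$ if $1-1/e\le|z|<1$. For $k=1,2,3,\dots$ let $v_k=v^k$ and let $H^\infty_{v_k}$ be the space of all analytic functions $f$ on $\mathbb D$ with $\|f\|_{v_k}:=\sup_{z\in\mathbb D}v_k(z)|f(z)|<\infty$. Let $VH(\mathbb D)=\bigcup_{k}H^\infty_{v_k}$, with the finest locally convex topology making all the inclusions $H^\infty_{v_k}\subset VH(\mathbb D)$ continuous. For a continuous linear operator $T$ on $VH(\mathbb D)$, the spectrum $\sigma(T)$ is the set of all $\lambda\in\mathbb C$ for which $\lambda I-T$ has no continuous linear inverse $R(\lambda,T)$ on $VH(\mathbb D)$, and the point spectrum $\sigma_{pt}(T)$ is the set of all $\lambda\in\mathbb C$ for which $\lambda I-T$ is not injective. Theorem. The Cesàro operator $$C f(z)=\frac1z\int_0^z\frac{f(\zeta)}{1-\zeta}\,d\zeta\quad(z\in\mathbb D\setminus\{0\}),\qquad Cf(0)=f(0),$$ is a well-defined continuous linear operator on $VH(\mathbb D)$, and the following hold. (i) $\sigma_{pt}(C)=\emptyset$.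 (ii) $\sigma(C)=\{0\}\cup\{\lambda\in\mathbb C:\operatorname{Re}\lambda>0\}$. (iii) For $t\ge0$ put $\varphi_t(z)=\dfrac{e^{-t}z}{(e^{-t}-1)z+1}$ and $S_tf(z)=\dfrac{\varphi_t(z)}{z}f(\varphi_t(z))$, where $\varphi_t(z)/z$ stands for $e^{-t}/((e^{-t}-1)z+1)$, also at $z=0$. Then $\varphi_t(\mathbb D)\subset\mathbb D$, $S_0=I$, $S_{s+t}=S_sS_t$ for $s,t\ge 0$, and $S_t$ maps each $H^\infty_{v_k}$ into itself with $\|S_th\|_{v_k}\le\|h\|_{v_k}$. If $\operatorname{Re}\lambda<0$, then for all $h\in VH(\mathbb D)$ and $z\in\mathbb D$ $$R(\lambda,C)h(z)=\frac{h(z)}{\lambda}+\frac1{\lambda^2}\int_0^\infty e^{t/\lambda}S_th(z)\,dt$$ with an absolutely convergent integral, and $R(\lambda,C)$ maps each $H^\infty_{v_k}$ into itself with $$\|R(\lambda,C)h\|_{v_k}\le\Big(\frac1{|\lambda|}+\frac1{|\operatorname{Re}\lambda|}\Big)\|h\|_{v_k}.$$ (iv) If $\operatorname{Re}\lambda=0$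 and $\lambda\ne0$, then for all $h\in VH(\mathbb D)$ and $z\in\mathbb D\setminus(-1,0]$ $$R(\lambda,C)h(z)=\frac{h(z)}{\lambda}+\frac1{\lambda^2}z^{1/\lambda-1}(1-z)^{-1/\lambda}\int_0^z\zeta^{-1/\lambda}(1-\zeta)^{1/\lambda-1}h(\zeta)\,d\zeta,$$ with principal branches of the powers and an absolutely convergent integral along the segment from $0$ to $z$; moreover there is a constant $M_\lambda$ such that, for every $k$ and every $h\in H^\infty_{v_k}$, $R(\lambda,C)h\in H^\infty_{v_{k+1}}$ and $\|R(\lambda,C)h\|_{v_{k+1}}\le M_\lambda\|h\|_{v_k}$. -/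

import Mathlib

noncomputable section

namespace LogGrowth

/-- The open unit disc of the complex plane. -/
def disc : Set ℂ := Metric.ball (0 : ℂ) 1

/-- The space `H(𝔻)` of analytic functions on the disc. A function on the disc is identified with
its extension by zero to `ℂ`, so that two elements are equal iff they agree on the disc. -/
def Hol : Submodule ℂ (ℂ → ℂ) where
  carrier := {f | DifferentiableOn ℂ f disc ∧ ∀ z, z ∉ disc → f z = 0}
  add_mem' := by
    rintro f g ⟨hf, hf'⟩ ⟨hg, hg'⟩
    exact ⟨hf.add hg, fun z hz => by simp [hf' z hz, hg' z hz]⟩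
  zero_mem' := ⟨differentiableOn_const (0 : ℂ), fun _ _ => rfl⟩
  smul_mem' := by
    rintro c f ⟨hf, hf'⟩
    exact ⟨hf.const_smul c, fun z hz => by simp [hf' z hz]⟩

/-- The logarithmic weight: `v(z) = 1` for `|z| ≤ 1 - 1/e` and `v(z) = (-log (1 - |z|))⁻¹` for
`1 - 1/e ≤ |z| < 1`. -/
def weight (z : ℂ) : ℝ :=
  if ‖z‖ ≤ 1 - 1 / Real.exp 1 then 1 else (-Real.log (1 - ‖z‖))⁻¹

theorem weight_pos {z : ℂ} (hz : z ∈ disc) : 0 < weight z := by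
  have hz' : ‖z‖ < 1 := by simpa [disc] using hz
  unfold weight
  split_ifs with h
  · exact one_pos
  · have h0 : 0 ≤ 1 - 1 / Real.exp 1 := by
      have : 1 / Real.exp 1 ≤ 1 := by
        rw [div_le_one (Real.exp_pos 1)]
        exact Real.one_le_exp zero_le_one
      linarith
    have h1 : 0 < 1 - ‖z‖ := by linarith
    have h2 : 1 - ‖z‖ < 1 := by linarith [not_le.mp h]
    have := Real.log_neg h1 h2
    exact inv_pos.mpr (by linarith)

/-- The underlying vector space of `H^∞_{v_k}`, `v_k = v ^ k`, `k = 1, 2, …`: the analytic functions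
`f` on the disc with `sup_{z ∈ 𝔻} v(z)^k |f(z)| < ∞`. -/
def stepSubmodule (k : ℕ+) : Submodule ℂ (ℂ → ℂ) where
  carrier := {f | f ∈ Hol ∧
    BddAbove (Set.range fun z : disc => weight z ^ (k : ℕ) * ‖f z‖)}
  add_mem' := by
    rintro f g ⟨hf, A, hA⟩ ⟨hg, B, hB⟩
    refine ⟨Hol.add_mem hf hg, A + B, ?_⟩
    rintro _ ⟨z, rfl⟩
    have h1 := hA ⟨z, rfl⟩
    have h2 := hB ⟨z, rfl⟩
    have h3 : 0 ≤ weight z ^ (k : ℕ) := (pow_pos (weight_pos z.2) _).le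
    have h4 := mul_le_mul_of_nonneg_left (norm_add_le (f z) (g z)) h3
    simp only [Pi.add_apply] at *
    linarith
  zero_mem' := ⟨Hol.zero_mem, 0, by rintro _ ⟨z, rfl⟩; simp⟩
  smul_mem' := by
    rintro c f ⟨hf, A, hA⟩
    refine ⟨Hol.smul_mem c hf, ‖c‖ * A, ?_⟩
    rintro _ ⟨z, rfl⟩
    have h1 := mul_le_mul_of_nonneg_left (hA ⟨z, rfl⟩) (norm_nonneg c)
    simp only [Pi.smul_apply, smul_eq_mul, norm_mul] at *
    linarith

/-- The weighted Banach space `H^∞_{v_k}`, `k = 1, 2, …`, of analytic functions on the disc. -/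
def Step (k : ℕ+) : Type := stepSubmodule k

namespace Step

variable {k : ℕ+}

instance : AddCommGroup (Step k) := inferInstanceAs (AddCommGroup (stepSubmodule k))

instance : Module ℂ (Step k) := inferInstanceAs (Module ℂ (stepSubmodule k))

/-- The function underlying an element of `H^∞_{v_k}`. -/
def toFun (f : Step k) : ℂ → ℂ := Subtype.val f

instance : CoeFun (Step k) (fun _ => ℂ → ℂ) := ⟨toFun⟩

/-- The norm `‖f‖_{v_k} = sup_{z ∈ 𝔻} v(z)^k |f(z)|`. -/
instance : Norm (Step k) := ⟨fun f => ⨆ z : disc, weight z ^ (k : ℕ) * ‖f z‖⟩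

theorem le_norm (f : Step k) (z : disc) : weight z ^ (k : ℕ) * ‖f z‖ ≤ ‖f‖ :=
  le_ciSup (Subtype.property f).2 z

instance : Nonempty disc := ⟨⟨0, by simp [disc]⟩⟩

theorem norm_le {f : Step k} {C : ℝ} (h : ∀ z : disc, weight z ^ (k : ℕ) * ‖f z‖ ≤ C) :
    ‖f‖ ≤ C := ciSup_le h

theorem norm_smul_le (c : ℂ) (f : Step k) : ‖c • f‖ ≤ ‖c‖ * ‖f‖ := by
  refine norm_le fun z => ?_
  have h : (c • f) (z : ℂ) = c * f z := rfl
  have h1 := mul_le_mul_of_nonneg_left (le_norm f z) (norm_nonneg c)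
  rw [h, norm_mul]
  linarith

theorem core : NormedSpace.Core ℂ (Step k) where
  norm_nonneg f :=
    le_trans (mul_nonneg (pow_pos (weight_pos (Subtype.property _)) _).le (norm_nonneg _))
      (le_norm f (Classical.arbitrary disc))
  norm_smul c f := by
    refine le_antisymm (norm_smul_le c f) ?_
    rcases eq_or_ne c 0 with rfl | hc
    · have h : 0 ≤ ‖(0 : ℂ) • f‖ :=
        le_trans (mul_nonneg (pow_pos (weight_pos (Subtype.property _)) _).le (norm_nonneg _))
          (le_norm _ (Classical.arbitrary disc))
      simpa using h
    · have h := norm_smul_le c⁻¹ (c • f)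
      rw [smul_smul, inv_mul_cancel₀ hc, one_smul, norm_inv] at h
      have hc' : 0 < ‖c‖ := norm_pos_iff.mpr hc
      calc ‖c‖ * ‖f‖ ≤ ‖c‖ * (‖c‖⁻¹ * ‖c • f‖) := mul_le_mul_of_nonneg_left h hc'.le
        _ = ‖c • f‖ := by field_simp
  norm_triangle f g := by
    refine norm_le fun z => ?_
    have h : (f + g) (z : ℂ) = f z + g z := rfl
    have h3 : 0 ≤ weight z ^ (k : ℕ) := (pow_pos (weight_pos z.2) _).le
    have h4 := mul_le_mul_of_nonneg_left (norm_add_le (f z) (g z)) h3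
    have h1 := le_norm f z
    have h2 := le_norm g z
    rw [h]
    linarith
  norm_eq_zero_iff f := by
    constructor
    · intro hf
      apply Subtype.ext
      funext z
      by_cases hz : z ∈ disc
      · have h := le_norm f ⟨z, hz⟩
        rw [hf] at h
        have hp : 0 < weight z ^ (k : ℕ) := pow_pos (weight_pos hz) _
        have h5 : ‖f z‖ ≤ 0 := by
          by_contra! hcon
          exact absurd h (not_le.mpr (mul_pos hp hcon))
        exact norm_le_zero_iff.mp h5
      · exact (Subtype.property f).1.2 z hz
    · rintro rfl
      have h : ∀ z : disc, weight z ^ (k : ℕ) * ‖(0 : Step k) z‖ = 0 := fun z => by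
        have h0 : (0 : Step k) (z : ℂ) = 0 := rfl
        simp [h0]
      exact (congrArg iSup (funext h)).trans ciSup_const

instance : NormedAddCommGroup (Step k) := NormedAddCommGroup.ofCore core

instance : NormedSpace ℂ (Step k) := NormedSpace.ofCore core

end Step

theorem weight_le_one {z : ℂ} (hz : z ∈ disc) : weight z ≤ 1 := by
  have hz' : ‖z‖ < 1 := by simpa [disc] using hz
  unfold weight
  split_ifs with h
  · exact le_rfl
  · have h1 : 0 < 1 - ‖z‖ := by linarith
    have h2 : 1 - ‖z‖ < Real.exp (-1) := by
      rw [Real.exp_neg, ← one_div]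
      linarith [not_le.mp h]
    have h3 : Real.log (1 - ‖z‖) < -1 := (Real.log_lt_iff_lt_exp h1).mpr h2
    exact inv_le_one_of_one_le₀ (by linarith)

theorem stepSubmodule_mono {k l : ℕ+} (h : k ≤ l) : stepSubmodule k ≤ stepSubmodule l := by
  rintro f ⟨hf, A, hA⟩
  refine ⟨hf, A, ?_⟩
  rintro _ ⟨z, rfl⟩
  refine le_trans ?_ (hA ⟨z, rfl⟩)
  exact mul_le_mul_of_nonneg_right
    (pow_le_pow_of_le_one (weight_pos z.2).le (weight_le_one z.2) h) (norm_nonneg _)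

/-- The underlying vector space of `VH(𝔻)`, the union of the spaces `H^∞_{v_k}`, `k = 1, 2, …`. -/
def vhSubmodule : Submodule ℂ (ℂ → ℂ) where
  carrier := ⋃ k : ℕ+, (stepSubmodule k : Set (ℂ → ℂ))
  add_mem' := by
    intro f g hf hg
    obtain ⟨k, hk⟩ := Set.mem_iUnion.mp hf
    obtain ⟨l, hl⟩ := Set.mem_iUnion.mp hg
    exact Set.mem_iUnion.mpr ⟨max k l, (stepSubmodule (max k l)).add_mem
      (stepSubmodule_mono (le_max_left k l) hk) (stepSubmodule_mono (le_max_right k l) hl)⟩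
  zero_mem' := Set.mem_iUnion.mpr ⟨1, (stepSubmodule 1).zero_mem⟩
  smul_mem' := by
    intro c f hf
    obtain ⟨k, hk⟩ := Set.mem_iUnion.mp hf
    exact Set.mem_iUnion.mpr ⟨k, (stepSubmodule k).smul_mem c hk⟩

/-- The space `VH(𝔻)` of analytic functions of logarithmic growth on the disc. -/
def VH : Type := vhSubmodule

namespace VH

instance : AddCommGroup VH := inferInstanceAs (AddCommGroup vhSubmodule)

instance : Module ℂ VH := inferInstanceAs (Module ℂ vhSubmodule)

/-- The function underlying an element of `VH(𝔻)`. -/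
def toFun (f : VH) : ℂ → ℂ := Subtype.val f

instance : CoeFun VH (fun _ => ℂ → ℂ) := ⟨toFun⟩

/-- The inclusion `H^∞_{v_k} ⊂ VH(𝔻)`. -/
def incl (k : ℕ+) : Step k →ₗ[ℂ] VH where
  toFun f := ⟨f.toFun, Set.mem_iUnion.mpr ⟨k, Subtype.property f⟩⟩
  map_add' _ _ := rfl
  map_smul' _ _ := rfl

/-- A locally convex vector space topology on `VH(𝔻)` for which all the inclusions
`H^∞_{v_k} ⊂ VH(𝔻)` are continuous. -/
structure IsCompatible (τ : TopologicalSpace VH) : Prop where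
  isTopologicalAddGroup : IsTopologicalAddGroup VH
  continuousSMul : ContinuousSMul ℂ VH
  locallyConvexSpace : LocallyConvexSpace ℝ VH
  continuous_incl : ∀ k, Continuous (incl k)

/-- The inductive limit topology of `VH(𝔻) = ind_k H^∞_{v_k}`: the finest locally convex topology
for which all the inclusions of the steps are continuous. (In Mathlib's order on topologies, finer
means smaller; the infimum is attained, see `isLeast_topology`.) -/
instance topology : TopologicalSpace VH := sInf {τ | IsCompatible τ}

theorem isLeast_topology : IsLeast {τ | IsCompatible τ} topology := by
  refine ⟨?_, fun τ hτ => sInf_le hτ⟩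
  refine ⟨?_, ?_, ?_, fun k => ?_⟩
  · exact topologicalAddGroup_sInf fun τ hτ => hτ.isTopologicalAddGroup
  · exact continuousSMul_sInf fun τ hτ => hτ.continuousSMul
  · exact LocallyConvexSpace.sInf fun τ hτ => hτ.locallyConvexSpace
  · exact continuous_sInf_rng.mpr fun τ hτ => hτ.continuous_incl k

instance : IsTopologicalAddGroup VH := isLeast_topology.1.isTopologicalAddGroup

instance : ContinuousSMul ℂ VH := isLeast_topology.1.continuousSMul

end VH

/-- The integral `∫_0^z f(ζ) dζ` along the segment from `0` to `z`. -/
def segmentIntegral (f : ℂ → ℂ) (z : ℂ) : ℂ := z * ∫ t in (0 : ℝ)..1, f (t * z)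

/-- The Cesàro operator: `C f (z) = (1/z) ∫_0^z f(ζ)/(1-ζ) dζ` for `z ≠ 0`, and `C f (0) = f(0)`. -/
def cesaro (f : ℂ → ℂ) (z : ℂ) : ℂ :=
  if z = 0 then f 0 else 1 / z * segmentIntegral (fun ζ => f ζ / (1 - ζ)) z

/-- The point spectrum of a continuous operator: all `lam` such that `lam I - T` is not
injective. -/
def pointSpectrum {X : Type*} [AddCommGroup X] [Module ℂ X] [TopologicalSpace X]
    [IsTopologicalAddGroup X] [ContinuousSMul ℂ X] (T : X →L[ℂ] X) : Set ℂ :=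
  {lam | ¬ Function.Injective (lam • ContinuousLinearMap.id ℂ X - T)}

/-- The self-maps `φ_t(z) = e^{-t} z / ((e^{-t} - 1) z + 1)` of the disc, `t ≥ 0`. -/
def phi (t : ℝ) (z : ℂ) : ℂ := Real.exp (-t) * z / ((Real.exp (-t) - 1) * z + 1)

/-- The weighted composition operators `S_t f (z) = (φ_t(z) / z) f(φ_t(z))`, `t ≥ 0`; the factor
`φ_t(z) / z` is the analytic function `e^{-t} / ((e^{-t} - 1) z + 1)`, also at `z = 0`. -/
def semigroupOp (t : ℝ) (f : ℂ → ℂ) (z : ℂ) : ℂ :=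
  Real.exp (-t) / ((Real.exp (-t) - 1) * z + 1) * f (phi t z)

/-- The integrand `ζ^{-1/lam} (1-ζ)^{1/lam-1} h(ζ)` (principal powers). -/
def resolventIntegrand (lam : ℂ) (h : ℂ → ℂ) (ζ : ℂ) : ℂ :=
  ζ ^ (-1 / lam) * (1 - ζ) ^ (1 / lam - 1) * h ζ

end LogGrowth

end

/-!
The proof rests on one family of explicit operators. Put `μ = 1/λ` and, for `Re μ ≤ 0`,
`K_μ h(z) = (1 - z)^{-μ} ∫_0^1 t^{-μ} (1 - tz)^{μ-1} h(tz) dt` (`kernelOp`). An integration by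
parts shows that `u = K_μ h` is holomorphic and solves `z (1 - z) u' + (1 - z) u = h + μ u`. In
particular `C = K_0`, and since `(z u)' = 0` has no nonzero holomorphic solution, the equations give
`K_μ - K_0 = μ K_0 K_μ` (`kernelOp_sub_kernelOp_zero`). Hence `μ + μ² K_μ` is a right inverse of
`λ - C`, and it is a two-sided inverse because `λ - C` is injective.

* Estimates. If `Re μ = 0`, the powers in the kernel have bounded modulus, and the remaining factor
  `∫_0^1 dt / (1 - t|z|)` costs one power of the weight (`weight_mul_kernelOp_le`). If `Re μ < 0`,
  the derivative of `e^{μt} S_t K_μ h` along the semigroup is `-e^{μt} S_t h`, so that `K_μ h` is the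
  Laplace transform of the orbit (`kernelOp_eq_integral`), and the contractivity of `S_t` bounds
  `K_μ` on each step. Step-to-step bounds give continuity for the inductive limit topology
  (`VH.continuous_of_comp_incl`).
* Injectivity. On `(0, 1)` the factor `x^{1-μ} (1 - x)^μ` turns the eigenvalue equation into
  `p' = 0`, `p = x^{1-μ} (1 - x)^μ f`. If `Re μ > 0` then `p` tends to `0` at `1` by logarithmic
  growth; if `Re μ < 1` then `p` tends to `0` at `0` (`VH.eq_zero_of_eigen`).
* Non-surjectivity for `Re λ > 0`. With right-hand side `z^n` and `n > Re μ`, the function `p` tends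
  to `0` at both ends while `p' = μ (n + 1) x^{n-μ} (1 - x)^μ` has integral a nonzero multiple of
  `B(n + 1 - μ, 1 + μ) ≠ 0`; when `λ = 1/(n+1)` the Taylor coefficients already exclude `z^n`
  (`exists_notMem_range`). For `λ = 0` the reflection of `C 1` has a preimage with a pole at `-1`
  (`exists_notMem_range_kernelOp_zero`).
-/

namespace LogGrowth

open Filter Topology

/-! ### The disc, the weight and operators on the inductive limit -/

theorem mem_disc {z : ℂ} : z ∈ disc ↔ ‖z‖ < 1 := by simp [disc]

theorem isOpen_disc : IsOpen disc := Metric.isOpen_ball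

theorem neg_mem_disc {z : ℂ} (hz : z ∈ disc) : -z ∈ disc := by
  simpa [mem_disc] using hz

theorem smul_mem_disc {z : ℂ} (hz : z ∈ disc) {t : ℝ} (ht : t ∈ Set.Icc (0 : ℝ) 1) :
    (t : ℂ) * z ∈ disc := by
  rw [mem_disc, norm_mul, Complex.norm_real, Real.norm_of_nonneg ht.1]
  exact lt_of_le_of_lt (mul_le_of_le_one_left (norm_nonneg z) ht.2) (mem_disc.1 hz)

theorem one_sub_re_pos {z : ℂ} (hz : z ∈ disc) : 0 < (1 - z).re := by
  have := (Complex.re_le_norm z).trans_lt (mem_disc.1 hz)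
  simpa using this

theorem one_sub_mem_slitPlane {z : ℂ} (hz : z ∈ disc) : 1 - z ∈ Complex.slitPlane :=
  Or.inl (one_sub_re_pos hz)

theorem one_sub_ne_zero {z : ℂ} (hz : z ∈ disc) : 1 - z ≠ 0 :=
  Complex.slitPlane_ne_zero (one_sub_mem_slitPlane hz)

theorem weight_neg (z : ℂ) : weight (-z) = weight z := by simp [weight]

theorem weight_mul_neg_log_le_one {z : ℂ} (hz : z ∈ disc) :
    weight z * -Real.log (1 - ‖z‖) ≤ 1 := by
  have h1 : 0 < 1 - ‖z‖ := sub_pos.2 (mem_disc.1 hz)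
  unfold weight
  split_ifs with h
  · have h2 : Real.exp (-1) ≤ 1 - ‖z‖ := by
      rw [Real.exp_neg, ← one_div]; linarith
    have := (Real.le_log_iff_exp_le h1).2 h2
    linarith
  · exact inv_mul_le_one

theorem weight_antitone {z w : ℂ} (hw : w ∈ disc) (h : ‖z‖ ≤ ‖w‖) : weight w ≤ weight z := by
  have hz : z ∈ disc := mem_disc.2 (h.trans_lt (mem_disc.1 hw))
  by_cases hz' : ‖z‖ ≤ 1 - 1 / Real.exp 1
  · rw [weight, weight, if_pos hz']
    simpa [weight] using weight_le_one hw
  · have hw' : ¬ ‖w‖ ≤ 1 - 1 / Real.exp 1 := fun h' => hz' (h.trans h')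
    have hp := weight_pos hz
    rw [weight, if_neg hz'] at hp
    rw [weight, weight, if_neg hz', if_neg hw']
    refine inv_anti₀ (inv_pos.1 hp) (neg_le_neg ?_)
    exact Real.log_le_log (sub_pos.2 (mem_disc.1 hw)) (by linarith)

theorem Step.differentiableOn {k : ℕ+} (f : Step k) : DifferentiableOn ℂ f disc :=
  (Subtype.property f).1.1

theorem Step.weight_mul_norm_le {k : ℕ+} (f : Step k) {z : ℂ} (hz : z ∈ disc) :
    weight z ^ (k : ℕ) * ‖f z‖ ≤ ‖f‖ := Step.le_norm f ⟨z, hz⟩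

/-- A holomorphic function with a bound on `v ^ k |u|` defines an element of `H^∞_{v_k}`, after
extension by zero. -/
theorem Step.exists_of_bound {k : ℕ+} {u : ℂ → ℂ} {M : ℝ} (hu : DifferentiableOn ℂ u disc)
    (hM : ∀ z ∈ disc, weight z ^ (k : ℕ) * ‖u z‖ ≤ M) :
    ∃ g : Step k, (∀ z ∈ disc, g z = u z) ∧ ‖g‖ ≤ M := by
  have hE : Set.EqOn (disc.indicator u) u disc := fun z hz => Set.indicator_of_mem hz u
  have hmem : disc.indicator u ∈ stepSubmodule k := by
    refine ⟨⟨hu.congr hE, fun z hz => Set.indicator_of_notMem hz u⟩, M, ?_⟩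
    rintro _ ⟨z, rfl⟩
    simpa only [hE z.2] using hM z z.2
  let g : Step k := ⟨disc.indicator u, hmem⟩
  have hg : ∀ z ∈ disc, g z = u z := hE
  exact ⟨g, hg, Step.norm_le fun z => by rw [hg z z.2]; exact hM z z.2⟩

namespace VH

theorem exists_incl (f : VH) : ∃ (k : ℕ+) (h : Step k), incl k h = f := by
  obtain ⟨k, hk⟩ := Set.mem_iUnion.mp (Subtype.property f)
  exact ⟨k, ⟨f.toFun, hk⟩, rfl⟩

theorem add_apply (f g : VH) (z : ℂ) : (f + g) z = f z + g z := rfl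

theorem smul_apply (c : ℂ) (f : VH) (z : ℂ) : (c • f) z = c * f z := rfl

theorem zero_apply (z : ℂ) : (0 : VH) z = 0 := rfl

theorem differentiableOn (f : VH) : DifferentiableOn ℂ f disc := by
  obtain ⟨k, h, rfl⟩ := f.exists_incl
  exact h.differentiableOn

theorem ext_disc {f g : VH} (h : ∀ z ∈ disc, f z = g z) : f = g := by
  have hout : ∀ (f : VH) (z : ℂ), z ∉ disc → f z = 0 := fun f z hz => by
    obtain ⟨k, h, rfl⟩ := f.exists_incl
    exact (Subtype.property h).1.2 z hz
  apply Subtype.ext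
  funext z
  by_cases hz : z ∈ disc
  · exact h z hz
  · exact (hout f z hz).trans (hout g z hz).symm

/-- The universal property of the inductive limit topology, for operators on `VH(𝔻)`: the topology
induced by `u` is among those whose infimum defines the topology of `VH(𝔻)`. -/
theorem continuous_of_comp_incl (u : VH →ₗ[ℂ] VH) (hu : ∀ k, Continuous (u ∘ incl k)) :
    Continuous u := by
  rw [continuous_iff_le_induced]
  refine isLeast_topology.2 ⟨?_, ?_, ?_, fun k => ?_⟩
  · exact topologicalAddGroup_induced u
  · exact continuousSMul_induced u
  · have : LocallyConvexSpace ℝ VH := isLeast_topology.1.locallyConvexSpace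
    exact LocallyConvexSpace.induced (u.restrictScalars ℝ)
  · exact continuous_induced_rng.2 (hu k)

theorem continuous_of_step_bound (u : VH →ₗ[ℂ] VH) (l : ℕ+ → ℕ+) (M : ℕ+ → ℝ)
    (hb : ∀ k (h : Step k), ∃ g : Step (l k), incl (l k) g = u (incl k h) ∧ ‖g‖ ≤ M k * ‖h‖) :
    Continuous u := by
  refine continuous_of_comp_incl u fun k => ?_
  have hinj : Function.Injective (incl (l k)) := fun a b hab =>
    Subtype.ext (congrArg Subtype.val hab : _)
  choose g hg hgM using hb k
  let G : Step k →ₗ[ℂ] Step (l k) :=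
    { toFun := g
      map_add' := fun a b => hinj (by simp only [map_add, hg])
      map_smul' := fun c a => hinj (by simp only [map_smul, hg, RingHom.id_apply]) }
  have hG : Continuous G := AddMonoidHomClass.continuous_of_bound G (M k) hgM
  have : (u ∘ incl k) = incl (l k) ∘ G := funext fun h => (hg h).symm
  rw [this]
  exact (isLeast_topology.1.continuous_incl (l k)).comp hG

/-- A linear operation on functions that satisfies weighted estimates between the steps
defines a continuous operator on `VH(𝔻)`. -/
theorem exists_operator (u : (ℂ → ℂ) → ℂ → ℂ) (l : ℕ+ → ℕ+) (M : ℕ+ → ℝ)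
    (hadd : ∀ f g : VH, ∀ z ∈ disc, u (fun ζ => f ζ + g ζ) z = u f z + u g z)
    (hsmul : ∀ (c : ℂ) (f : VH), ∀ z ∈ disc, u (fun ζ => c * f ζ) z = c * u f z)
    (hd : ∀ f : VH, DifferentiableOn ℂ (u f) disc)
    (hb : ∀ k (h : Step k), ∀ z ∈ disc, weight z ^ (l k : ℕ) * ‖u h z‖ ≤ M k * ‖h‖) :
    ∃ T : VH →L[ℂ] VH, ∀ f : VH, ∀ z ∈ disc, T f z = u f z := by
  have hex : ∀ f : VH, ∃ g : VH, ∀ z ∈ disc, g z = u f z := fun f => by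
    obtain ⟨k, h, rfl⟩ := f.exists_incl
    obtain ⟨g, hg, -⟩ := Step.exists_of_bound (hd (incl k h)) (hb k h)
    exact ⟨incl _ g, hg⟩
  choose T hT using hex
  let T' : VH →ₗ[ℂ] VH :=
    { toFun := T
      map_add' := fun f g => ext_disc fun z hz => by
        rw [hT _ z hz, add_apply, hT _ z hz, hT _ z hz]
        exact hadd f g z hz
      map_smul' := fun c f => ext_disc fun z hz => by
        rw [hT _ z hz, RingHom.id_apply, smul_apply, hT _ z hz]
        exact hsmul c f z hz }
  have hbT : ∀ k (h : Step k), ∃ g : Step (l k),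
      incl (l k) g = T' (incl k h) ∧ ‖g‖ ≤ M k * ‖h‖ := fun k h => by
    obtain ⟨g, hg, hM⟩ := Step.exists_of_bound (hd (incl k h)) (hb k h)
    exact ⟨g, ext_disc fun z hz => (hg z hz).trans (hT _ z hz).symm, hM⟩
  exact ⟨⟨T', continuous_of_step_bound T' l M hbT⟩, hT⟩

end VH

/-- Functions in `VH(𝔻)` grow more slowly than every power of `1 / (1 - |z|)`. -/
theorem VH.tendsto_rpow_mul_norm (f : VH) {w : ℂ} (hw : ‖w‖ = 1) {r : ℝ} (hr : 0 < r) :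
    Tendsto (fun x : ℝ => (1 - x) ^ r * ‖f (x * w)‖) (𝓝[<] 1) (𝓝 0) := by
  obtain ⟨k, h, rfl⟩ := f.exists_incl
  have hk : 0 < (k : ℕ) := k.pos
  have hsub : Tendsto (fun x : ℝ => 1 - x) (𝓝[<] 1) (𝓝[>] 0) := by
    refine tendsto_nhdsWithin_iff.2 ⟨?_, ?_⟩
    · have : Tendsto (fun x : ℝ => 1 - x) (𝓝 1) (𝓝 (1 - 1)) :=
        (continuous_const.sub continuous_id).tendsto 1
      rw [sub_self] at this
      exact this.mono_left nhdsWithin_le_nhds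
    · filter_upwards [self_mem_nhdsWithin] with x hx using sub_pos.2 (Set.mem_Iio.1 hx)
  have h1 := ((tendsto_log_mul_rpow_nhdsGT_zero (div_pos hr (Nat.cast_pos.2 hk))).comp hsub).norm
  have h2 := (h1.pow (k : ℕ)).const_mul ‖h‖
  rw [norm_zero, zero_pow hk.ne', mul_zero] at h2
  have hlt : (0 : ℝ) ≤ 1 - 1 / Real.exp 1 := by
    rw [sub_nonneg, div_le_one (Real.exp_pos 1)]
    exact Real.one_le_exp zero_le_one
  have hlt' : (1 - 1 / Real.exp 1 : ℝ) < 1 := by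
    have := Real.exp_pos 1
    have : 0 < 1 / Real.exp 1 := by positivity
    linarith
  refine squeeze_zero' ?_ ?_ h2
  · filter_upwards [self_mem_nhdsWithin] with x hx
    have : (0 : ℝ) ≤ 1 - x := sub_nonneg.2 (le_of_lt (Set.mem_Iio.1 hx))
    positivity
  · filter_upwards [self_mem_nhdsWithin, mem_nhdsWithin_of_mem_nhds (Ioi_mem_nhds hlt')]
      with x hx hx'
    have hx1 : x < 1 := hx
    have hx' : 1 - 1 / Real.exp 1 < x := hx'
    have hx0 : 0 < 1 - x := sub_pos.2 hx1
    have hnorm : ‖(x : ℂ) * w‖ = x := by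
      rw [norm_mul, hw, mul_one, Complex.norm_real, Real.norm_of_nonneg (hlt.trans hx'.le)]
    have hz : (x : ℂ) * w ∈ disc := mem_disc.2 (by rw [hnorm]; exact hx)
    have hb := h.weight_mul_norm_le hz
    have hp := weight_pos hz
    rw [weight, hnorm, if_neg (not_le.2 hx')] at hb hp
    have hl : 0 < -Real.log (1 - x) := inv_pos.1 hp
    rw [inv_pow, inv_mul_le_iff₀ (pow_pos hl _)] at hb
    have hpow : ((1 - x) ^ (r / (k : ℕ))) ^ (k : ℕ) = (1 - x) ^ r := by
      rw [← Real.rpow_natCast, ← Real.rpow_mul hx0.le, div_mul_cancel₀]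
      exact_mod_cast hk.ne'
    simp only [Function.comp_apply, norm_mul, mul_pow]
    rw [Real.norm_of_nonneg (Real.rpow_nonneg hx0.le _), hpow, Real.norm_eq_abs,
      abs_of_neg (by linarith)]
    calc (1 - x) ^ r * ‖h (x * w)‖ ≤ (1 - x) ^ r * ((-Real.log (1 - x)) ^ (k : ℕ) * ‖h‖) :=
          mul_le_mul_of_nonneg_left hb (Real.rpow_nonneg hx0.le _)
      _ = _ := by ring

/-! ### Radial averages -/

/-- The weighted radial average `∫_0^1 t^a q(tz) dt`. -/
noncomputable def radialAverage (a : ℂ) (q : ℂ → ℂ) (z : ℂ) : ℂ :=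
  ∫ t in (0 : ℝ)..1, (t : ℂ) ^ a * q (t * z)

theorem continuousOn_comp_radial {q : ℂ → ℂ} (hq : ContinuousOn q disc) {z : ℂ} (hz : z ∈ disc) :
    ContinuousOn (fun t : ℝ => q (t * z)) (Set.Icc 0 1) :=
  hq.comp (by fun_prop) fun _ ht => smul_mem_disc hz ht

theorem intervalIntegrable_radial {a : ℂ} (ha : -1 < a.re) {q : ℂ → ℂ} (hq : ContinuousOn q disc)
    {z : ℂ} (hz : z ∈ disc) :
    IntervalIntegrable (fun t : ℝ => (t : ℂ) ^ a * q (t * z)) MeasureTheory.volume 0 1 :=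
  (intervalIntegral.intervalIntegrable_cpow' ha).mul_continuousOn
    (by rw [Set.uIcc_of_le zero_le_one]; exact continuousOn_comp_radial hq hz)

theorem norm_ofReal_cpow_le_one {a : ℂ} (ha : 0 ≤ a.re) {t : ℝ} (ht : t ∈ Set.Ioc (0 : ℝ) 1) :
    ‖(t : ℂ) ^ a‖ ≤ 1 := by
  rw [Complex.norm_cpow_eq_rpow_re_of_pos ht.1]
  exact Real.rpow_le_one ht.1.le ht.2 ha

theorem hasDerivAt_deriv_of_disc {q : ℂ → ℂ} (hq : DifferentiableOn ℂ q disc) {z : ℂ}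
    (hz : z ∈ disc) : HasDerivAt q (deriv q z) z :=
  (hq.differentiableAt (isOpen_disc.mem_nhds hz)).hasDerivAt

theorem continuousOn_deriv_of_disc {q : ℂ → ℂ} (hq : DifferentiableOn ℂ q disc) :
    ContinuousOn (deriv q) disc :=
  (hq.deriv isOpen_disc).continuousOn

theorem hasDerivAt_radialAverage {a : ℂ} (ha : 0 ≤ a.re) {q : ℂ → ℂ}
    (hq : DifferentiableOn ℂ q disc) {z : ℂ} (hz : z ∈ disc) :
    HasDerivAt (radialAverage a q) (radialAverage (a + 1) (deriv q) z) z := by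
  have ha' : -1 < a.re := by linarith
  have ha1 : -1 < (a + 1).re := by simp; linarith
  obtain ⟨ρ, hzρ, hρ⟩ := exists_between (mem_disc.1 hz)
  have hball : Metric.closedBall (0 : ℂ) ρ ⊆ disc := fun w hw =>
    mem_disc.2 ((mem_closedBall_zero_iff.1 hw).trans_lt hρ)
  obtain ⟨M, hM⟩ := (isCompact_closedBall (0 : ℂ) ρ).exists_bound_of_continuousOn
    ((continuousOn_deriv_of_disc hq).mono hball)
  have hs : Metric.ball (0 : ℂ) ρ ∈ 𝓝 z :=
    Metric.isOpen_ball.mem_nhds (mem_ball_zero_iff.2 hzρ)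
  have hsub : Metric.ball (0 : ℂ) ρ ⊆ disc := Metric.ball_subset_closedBall.trans hball
  refine (intervalIntegral.hasDerivAt_integral_of_dominated_loc_of_deriv_le
    (F := fun (w : ℂ) (t : ℝ) => (t : ℂ) ^ a * q (t * w))
    (F' := fun (w : ℂ) (t : ℝ) => (t : ℂ) ^ (a + 1) * deriv q (t * w))
    (bound := fun _ => M) hs ?_ ?_ ?_ ?_ ?_ ?_).2
  · filter_upwards [hs] with w hw
    have := intervalIntegrable_radial ha' hq.continuousOn (hsub hw)
    exact (intervalIntegrable_iff.1 this).aestronglyMeasurable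
  · exact intervalIntegrable_radial ha' hq.continuousOn hz
  · have := intervalIntegrable_radial ha1 (continuousOn_deriv_of_disc hq) hz
    exact (intervalIntegrable_iff.1 this).aestronglyMeasurable
  · refine Eventually.of_forall fun t ht w hw => ?_
    rw [Set.uIoc_of_le zero_le_one] at ht
    have h1 : ‖(t : ℂ) ^ (a + 1)‖ ≤ 1 :=
      norm_ofReal_cpow_le_one (by simp; linarith) ht
    have h2 : ‖deriv q (t * w)‖ ≤ M := by
      refine hM _ (mem_closedBall_zero_iff.2 ?_)
      rw [norm_mul, Complex.norm_real, Real.norm_of_nonneg ht.1.le]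
      exact (mul_le_of_le_one_left (norm_nonneg w) ht.2).trans (mem_ball_zero_iff.1 hw).le
    rw [norm_mul]
    exact (mul_le_of_le_one_left (norm_nonneg _) h1).trans h2
  · exact intervalIntegrable_const
  · refine Eventually.of_forall fun t ht w hw => ?_
    rw [Set.uIoc_of_le zero_le_one] at ht
    have hd := hasDerivAt_deriv_of_disc hq (smul_mem_disc (hsub hw) ⟨ht.1.le, ht.2⟩)
    have hm : HasDerivAt (fun w : ℂ => (t : ℂ) * w) (t : ℂ) w := by
      simpa using (hasDerivAt_id w).const_mul (t : ℂ)
    have := (hd.comp w hm).const_mul ((t : ℂ) ^ a)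
    rw [Complex.cpow_add _ _ (Complex.ofReal_ne_zero.2 ht.1.ne'), Complex.cpow_one]
    exact this.congr_deriv (by ring)

/-- Integration by parts in the radial average: `d/dt (t^{a+1} q(tz))` integrates to `q(z)`. -/
theorem radialAverage_ode {a : ℂ} (ha : 0 ≤ a.re) {q : ℂ → ℂ}
    (hq : DifferentiableOn ℂ q disc) {z : ℂ} (hz : z ∈ disc) :
    z * radialAverage (a + 1) (deriv q) z + (a + 1) * radialAverage a q z = q z := by
  have ha' : -1 < a.re := by linarith
  have ha1 : 0 < (a + 1).re := by simp; linarith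
  have ha1' : -1 < (a + 1).re := by linarith
  have ha0 : a + 1 ≠ 0 := fun h => by rw [h] at ha1; simp at ha1
  have hi1 := (intervalIntegrable_radial ha1' (continuousOn_deriv_of_disc hq) hz).const_mul z
  have hi2 := (intervalIntegrable_radial ha' hq.continuousOn hz).const_mul (a + 1)
  have key := intervalIntegral.integral_eq_sub_of_hasDerivAt_of_le zero_le_one
    (f := fun t : ℝ => (t : ℂ) ^ (a + 1) * q (t * z))
    (f' := fun t : ℝ => z * ((t : ℂ) ^ (a + 1) * deriv q (t * z))
      + (a + 1) * ((t : ℂ) ^ a * q (t * z))) ?_ ?_ (hi1.add hi2)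
  · rw [radialAverage, radialAverage, ← intervalIntegral.integral_const_mul,
      ← intervalIntegral.integral_const_mul, ← intervalIntegral.integral_add hi1 hi2, key]
    simp [Complex.zero_cpow ha0]
  · exact (Complex.continuous_ofReal_cpow_const ha1).continuousOn.mul
      (continuousOn_comp_radial hq.continuousOn hz)
  · intro t ht
    have hd := hasDerivAt_deriv_of_disc hq (smul_mem_disc hz ⟨ht.1.le, ht.2.le⟩)
    have hm : HasDerivAt (fun t : ℝ => (t : ℂ) * z) z t := by
      simpa using (Complex.ofRealCLM.hasDerivAt (x := t)).mul_const z
    have hp := hasDerivAt_ofReal_cpow_const ht.1.ne' ha0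
    rw [add_sub_cancel_right] at hp
    have hc : HasDerivAt (fun t : ℝ => q (t * z)) (deriv q (t * z) * z) t :=
      HasDerivAt.comp (h₂ := q) t hd hm
    exact (hp.mul hc).congr_deriv (by ring)

/-! ### The resolvent kernel -/

/-- The operator
`K_μ h(z) = (1 - z)^{-μ} ∫_0^1 t^{-μ} (1 - tz)^{μ - 1} h(tz) dt`, which for `Re μ ≤ 0` gives the
analytic solution of `z (1 - z) u' + (1 - z) u = h + μ u`. The Cesàro operator is `K_0`. -/
noncomputable def kernelOp (μ : ℂ) (h : ℂ → ℂ) (z : ℂ) : ℂ :=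
  (1 - z) ^ (-μ) * radialAverage (-μ) (fun ζ => (1 - ζ) ^ (μ - 1) * h ζ) z

theorem hasDerivAt_one_sub_cpow (c : ℂ) {z : ℂ} (hz : z ∈ disc) :
    HasDerivAt (fun ζ : ℂ => (1 - ζ) ^ c) (-(c * (1 - z) ^ (c - 1))) z := by
  have := ((hasDerivAt_id z).const_sub 1).cpow_const (c := c) (one_sub_mem_slitPlane hz)
  simpa using this

theorem differentiableOn_one_sub_cpow_mul (c : ℂ) {h : ℂ → ℂ} (hh : DifferentiableOn ℂ h disc) :
    DifferentiableOn ℂ (fun ζ => (1 - ζ) ^ c * h ζ) disc :=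
  DifferentiableOn.mul
    (fun _ hz => (hasDerivAt_one_sub_cpow c hz).differentiableAt.differentiableWithinAt) hh

theorem kernelOp_hasDerivAt {μ : ℂ} (hμ : μ.re ≤ 0) {h : ℂ → ℂ}
    (hh : DifferentiableOn ℂ h disc) {z : ℂ} (hz : z ∈ disc) :
    ∃ d, HasDerivAt (kernelOp μ h) d z ∧
      z * (1 - z) * d + (1 - z) * kernelOp μ h z = h z + μ * kernelOp μ h z := by
  have ha : 0 ≤ (-μ).re := by simpa using hμ
  have hq := differentiableOn_one_sub_cpow_mul (μ - 1) hh
  refine ⟨_, (hasDerivAt_one_sub_cpow (-μ) hz).mul (hasDerivAt_radialAverage ha hq hz), ?_⟩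
  have hode := radialAverage_ode ha hq hz
  have h0 := one_sub_ne_zero hz
  have e1 : (1 - z) * (1 - z) ^ (-μ - 1) = (1 - z) ^ (-μ) := by
    rw [Complex.cpow_sub _ _ h0, Complex.cpow_one, mul_div_cancel₀ _ h0]
  have e2 : (1 - z) * (1 - z) ^ (-μ) * (1 - z) ^ (μ - 1) = 1 := by
    rw [mul_assoc, ← Complex.cpow_add _ _ h0, neg_add_eq_sub, sub_sub_cancel_left, Complex.cpow_neg,
      Complex.cpow_one, mul_inv_cancel₀ h0]
  rw [kernelOp]
  linear_combination ((1 - z) * (1 - z) ^ (-μ)) * hode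
    + (μ * z * radialAverage (-μ) (fun ζ => (1 - ζ) ^ (μ - 1) * h ζ) z) * e1 + h z * e2

theorem kernelOp_differentiableOn {μ : ℂ} (hμ : μ.re ≤ 0) {h : ℂ → ℂ}
    (hh : DifferentiableOn ℂ h disc) : DifferentiableOn ℂ (kernelOp μ h) disc := fun _ hz =>
  (kernelOp_hasDerivAt hμ hh hz).choose_spec.1.differentiableAt.differentiableWithinAt

theorem kernelOp_ode {μ : ℂ} (hμ : μ.re ≤ 0) {h : ℂ → ℂ}
    (hh : DifferentiableOn ℂ h disc) {z : ℂ} (hz : z ∈ disc) :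
    z * (1 - z) * deriv (kernelOp μ h) z + (1 - z) * kernelOp μ h z
      = h z + μ * kernelOp μ h z := by
  obtain ⟨d, hd, he⟩ := kernelOp_hasDerivAt hμ hh hz
  rwa [hd.deriv]

theorem kernelOp_add {μ : ℂ} (hμ : μ.re ≤ 0) {f g : ℂ → ℂ} (hf : DifferentiableOn ℂ f disc)
    (hg : DifferentiableOn ℂ g disc) {z : ℂ} (hz : z ∈ disc) :
    kernelOp μ (fun ζ => f ζ + g ζ) z = kernelOp μ f z + kernelOp μ g z := by
  have ha : -1 < (-μ).re := by simp; linarith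
  have h1 := intervalIntegrable_radial ha
    (differentiableOn_one_sub_cpow_mul (μ - 1) hf).continuousOn hz
  have h2 := intervalIntegrable_radial ha
    (differentiableOn_one_sub_cpow_mul (μ - 1) hg).continuousOn hz
  rw [kernelOp, kernelOp, kernelOp, ← mul_add, radialAverage, radialAverage, radialAverage,
    ← intervalIntegral.integral_add h1 h2]
  simp only [mul_add]

theorem kernelOp_const_mul (μ c : ℂ) (f : ℂ → ℂ) (z : ℂ) :
    kernelOp μ (fun ζ => c * f ζ) z = c * kernelOp μ f z := by
  rw [kernelOp, kernelOp, mul_left_comm c, radialAverage, radialAverage,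
    ← intervalIntegral.integral_const_mul c]
  congr 2
  funext t
  ring

theorem cesaro_eq_kernelOp (f : ℂ → ℂ) (z : ℂ) : cesaro f z = kernelOp 0 f z := by
  have e : ∀ w : ℂ, kernelOp 0 f w = ∫ t in (0 : ℝ)..1, f (t * w) / (1 - t * w) := fun w => by
    simp [kernelOp, radialAverage, Complex.cpow_neg, div_eq_inv_mul]
  rw [e, cesaro, segmentIntegral]
  split_ifs with h
  · simp [h]
  · rw [← mul_assoc, one_div_mul_cancel h, one_mul]

/-- A holomorphic solution of `(z u)' = 0` on the disc vanishes. -/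
theorem eq_zero_of_ode {u : ℂ → ℂ} (hu : DifferentiableOn ℂ u disc)
    (h : ∀ z ∈ disc, z * deriv u z + u z = 0) {z : ℂ} (hz : z ∈ disc) : u z = 0 := by
  have h0 : (0 : ℂ) ∈ disc := by simp [mem_disc]
  by_cases hz0 : z = 0
  · simpa [hz0] using h 0 h0
  have hc : ∀ w ∈ disc, HasDerivAt (fun w => w * u w) 0 w := fun w hw => by
    refine ((hasDerivAt_id w).mul (hasDerivAt_deriv_of_disc hu hw)).congr_deriv ?_
    have := h w hw
    simp only [id]
    linear_combination this
  have hconst := isOpen_disc.is_const_of_deriv_eq_zero (f := fun w => w * u w)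
    (convex_ball (0 : ℂ) 1).isPreconnected
    (fun w hw => (hc w hw).differentiableAt.differentiableWithinAt)
    (fun w hw => (hc w hw).deriv) hz h0
  simpa [hz0] using hconst

/-- The resolvent identity `K_μ - K_0 = μ K_0 K_μ`: both sides solve the same equation. -/
theorem kernelOp_sub_kernelOp_zero {μ : ℂ} (hμ : μ.re ≤ 0) {h : ℂ → ℂ}
    (hh : DifferentiableOn ℂ h disc) {z : ℂ} (hz : z ∈ disc) :
    kernelOp μ h z - kernelOp 0 h z = μ * kernelOp 0 (kernelOp μ h) z := by
  have h0 : (0 : ℂ).re ≤ 0 := le_rfl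
  have hK := kernelOp_differentiableOn hμ hh
  have hd1 : ∀ w ∈ disc, _ := fun w hw => hasDerivAt_deriv_of_disc hK hw
  have hd2 : ∀ w ∈ disc, _ := fun w hw =>
    hasDerivAt_deriv_of_disc (kernelOp_differentiableOn h0 hh) hw
  have hd3 : ∀ w ∈ disc, _ := fun w hw =>
    hasDerivAt_deriv_of_disc (kernelOp_differentiableOn h0 hK) hw
  have hd : ∀ w ∈ disc, _ := fun w hw =>
    ((hd1 w hw).sub (hd2 w hw)).sub ((hd3 w hw).const_mul μ)
  refine sub_eq_zero.1 (eq_zero_of_ode (u := fun z =>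
    kernelOp μ h z - kernelOp 0 h z - μ * kernelOp 0 (kernelOp μ h) z)
    (fun w hw => (hd w hw).differentiableAt.differentiableWithinAt) (fun w hw => ?_) hz)
  have e : deriv (fun z => kernelOp μ h z - kernelOp 0 h z - μ * kernelOp 0 (kernelOp μ h) z) w
    = _ := (hd w hw).deriv
  rw [e]
  have e1 := kernelOp_ode hμ hh hw
  have e2 := kernelOp_ode h0 hh hw
  have e3 := kernelOp_ode h0 hK hw
  refine (mul_eq_zero.1 ?_).resolve_left (one_sub_ne_zero hw)
  linear_combination e1 - e2 - μ * e3

/-! ### Weighted estimates on the imaginary axis -/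

theorem weight_mul_integral_le {z : ℂ} (hz : z ∈ disc) :
    weight z * ∫ t in (0 : ℝ)..1, (1 - t * ‖z‖)⁻¹ ≤ 2 := by
  have hr1 := mem_disc.1 hz
  have hr0 := norm_nonneg z
  have hw := (weight_pos hz).le
  have hw1 := weight_le_one hz
  set r := ‖z‖ with hr
  have hpos : ∀ t ∈ Set.Icc (0 : ℝ) 1, 0 < 1 - t * r := fun t ht => by
    have := mul_le_of_le_one_left hr0 ht.2
    linarith
  have hcont : ContinuousOn (fun t : ℝ => (1 - t * r)⁻¹) (Set.uIcc 0 1) := by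
    rw [Set.uIcc_of_le zero_le_one]
    exact ContinuousOn.inv₀ (by fun_prop) fun t ht => (hpos t ht).ne'
  by_cases hr2 : r ≤ 1 / 2
  · have hI : ∫ t in (0 : ℝ)..1, (1 - t * r)⁻¹ ≤ ∫ t in (0 : ℝ)..1, (2 : ℝ) := by
      refine intervalIntegral.integral_mono_on zero_le_one hcont.intervalIntegrable
        intervalIntegrable_const fun t ht => ?_
      have : (1 / 2 : ℝ) ≤ 1 - t * r := by
        have := mul_le_of_le_one_left hr0 ht.2
        linarith
      calc (1 - t * r)⁻¹ ≤ (1 / 2 : ℝ)⁻¹ := inv_anti₀ (by norm_num) this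
        _ = 2 := by norm_num
    have hI0 : 0 ≤ ∫ t in (0 : ℝ)..1, (1 - t * r)⁻¹ :=
      intervalIntegral.integral_nonneg zero_le_one fun t ht => inv_nonneg.2 (hpos t ht).le
    calc _ ≤ 1 * ∫ t in (0 : ℝ)..1, (1 - t * r)⁻¹ := mul_le_mul_of_nonneg_right hw1 hI0
      _ ≤ 2 := by simpa using hI
  · have hr2 : 1 / 2 < r := not_le.1 hr2
    have hrpos : 0 < r := by linarith
    have hI : ∫ t in (0 : ℝ)..1, (1 - t * r)⁻¹
        = -Real.log (1 - 1 * r) / r - -Real.log (1 - 0 * r) / r := by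
      refine intervalIntegral.integral_eq_sub_of_hasDerivAt (f := fun t : ℝ =>
        -Real.log (1 - t * r) / r) (fun t ht => ?_) hcont.intervalIntegrable
      rw [Set.uIcc_of_le zero_le_one] at ht
      have h1 : HasDerivAt (fun t : ℝ => 1 - t * r) (-r) t := by
        simpa using ((hasDerivAt_id t).mul_const r).const_sub 1
      refine ((h1.log (hpos t ht).ne').neg.div_const r).congr_deriv ?_
      have := (hpos t ht).ne'
      field_simp
    have hlog := weight_mul_neg_log_le_one hz
    rw [hI, one_mul, zero_mul, sub_zero, Real.log_one, neg_zero, zero_div, sub_zero, ← mul_div_assoc,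
      div_le_iff₀ hrpos]
    linarith

theorem norm_one_sub_cpow_le (ν z : ℂ) :
    ‖(1 - z) ^ ν‖ ≤ ‖1 - z‖ ^ ν.re * Real.exp (Real.pi * ‖ν‖) := by
  refine (Complex.norm_cpow_le _ _).trans ?_
  rw [div_eq_mul_inv, ← Real.exp_neg]
  refine mul_le_mul_of_nonneg_left (Real.exp_le_exp.2 ?_) (Real.rpow_nonneg (norm_nonneg _) _)
  refine (neg_le_abs _).trans ?_
  rw [abs_mul]
  exact mul_le_mul (Complex.abs_arg_le_pi _) (Complex.abs_im_le_norm ν) (abs_nonneg _) Real.pi_pos.le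

/-- On the imaginary axis `K_μ` loses only the logarithmic factor `∫_0^1 dt / (1 - t|z|)`, since
the powers in its kernel have bounded modulus. -/
theorem weight_mul_kernelOp_le {μ : ℂ} (hμ : μ.re = 0) {k : ℕ+} (h : Step k) {z : ℂ}
    (hz : z ∈ disc) :
    weight z ^ ((k + 1 : ℕ+) : ℕ) * ‖kernelOp μ h z‖
      ≤ 2 * Real.exp (Real.pi * ‖μ‖) * Real.exp (Real.pi * ‖μ - 1‖) * ‖h‖ := by
  have hw := weight_pos hz
  have hr0 := norm_nonneg z
  have hr1 := mem_disc.1 hz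
  set E := Real.exp (Real.pi * ‖μ - 1‖)
  have hpos : ∀ t ∈ Set.Icc (0 : ℝ) 1, 0 < 1 - t * ‖z‖ := fun t ht => by
    have := mul_le_of_le_one_left hr0 ht.2
    linarith
  have hcont : ContinuousOn (fun t : ℝ => (1 - t * ‖z‖)⁻¹) (Set.uIcc 0 1) := by
    rw [Set.uIcc_of_le zero_le_one]
    exact ContinuousOn.inv₀ (by fun_prop) fun t ht => (hpos t ht).ne'
  have hA : ‖(1 - z) ^ (-μ)‖ ≤ Real.exp (Real.pi * ‖μ‖) := by
    simpa [hμ] using norm_one_sub_cpow_le (-μ) z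
  have hR : weight z ^ (k : ℕ) * ‖radialAverage (-μ) (fun ζ => (1 - ζ) ^ (μ - 1) * h ζ) z‖
      ≤ E * ‖h‖ * ∫ t in (0 : ℝ)..1, (1 - t * ‖z‖)⁻¹ := by
    rw [← Real.norm_of_nonneg (pow_pos hw (k : ℕ)).le, ← Complex.norm_real, ← norm_mul,
      radialAverage, ← intervalIntegral.integral_const_mul, ← intervalIntegral.integral_const_mul]
    refine intervalIntegral.norm_integral_le_of_norm_le zero_le_one
      (Eventually.of_forall fun t ht => ?_) (hcont.intervalIntegrable.const_mul _)
    have ht' : t ∈ Set.Icc (0 : ℝ) 1 := ⟨ht.1.le, ht.2⟩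
    have htz := smul_mem_disc hz ht'
    have hnorm : ‖(t : ℂ) * z‖ = t * ‖z‖ := by
      rw [norm_mul, Complex.norm_real, Real.norm_of_nonneg ht.1.le]
    have h1 : ‖(t : ℂ) ^ (-μ)‖ ≤ 1 := norm_ofReal_cpow_le_one (by simp [hμ]) ht
    have h2 : weight z ^ (k : ℕ) * ‖h (t * z)‖ ≤ ‖h‖ := by
      refine le_trans (mul_le_mul_of_nonneg_right (pow_le_pow_left₀ hw.le
        (weight_antitone hz ?_) _) (norm_nonneg _)) (h.weight_mul_norm_le htz)
      rw [hnorm]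
      exact mul_le_of_le_one_left hr0 ht.2
    have h3 : ‖(1 - (t : ℂ) * z) ^ (μ - 1)‖ ≤ E * (1 - t * ‖z‖)⁻¹ := by
      refine (norm_one_sub_cpow_le _ _).trans ?_
      have : (μ - 1).re = -1 := by simp [hμ]
      rw [this, Real.rpow_neg_one, mul_comm]
      refine mul_le_mul_of_nonneg_left (inv_anti₀ (hpos t ht') ?_) (Real.exp_pos _).le
      have := norm_sub_norm_le (1 : ℂ) (t * z)
      rwa [norm_one, hnorm] at this
    have hE : 0 ≤ E * (1 - t * ‖z‖)⁻¹ :=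
      mul_nonneg (Real.exp_pos _).le (inv_nonneg.2 (hpos t ht').le)
    rw [norm_mul, Complex.norm_real, Real.norm_of_nonneg (pow_pos hw (k : ℕ)).le, norm_mul,
      norm_mul]
    calc weight z ^ (k : ℕ)
          * (‖(t : ℂ) ^ (-μ)‖ * (‖(1 - (t : ℂ) * z) ^ (μ - 1)‖ * ‖h (t * z)‖))
        = ‖(t : ℂ) ^ (-μ)‖ * (‖(1 - (t : ℂ) * z) ^ (μ - 1)‖
            * (weight z ^ (k : ℕ) * ‖h (t * z)‖)) := by ring
      _ ≤ 1 * (E * (1 - t * ‖z‖)⁻¹ * ‖h‖) := by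
          gcongr
      _ = _ := by ring
  have hI := weight_mul_integral_le hz
  rw [PNat.add_coe, PNat.one_coe, pow_succ, kernelOp, norm_mul]
  calc weight z ^ (k : ℕ) * weight z * (‖(1 - z) ^ (-μ)‖ * _)
      = ‖(1 - z) ^ (-μ)‖ * (weight z * (weight z ^ (k : ℕ)
        * ‖radialAverage (-μ) (fun ζ => (1 - ζ) ^ (μ - 1) * h ζ) z‖)) := by ring
    _ ≤ Real.exp (Real.pi * ‖μ‖)
        * (weight z * (E * ‖h‖ * ∫ t in (0 : ℝ)..1, (1 - t * ‖z‖)⁻¹)) := by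
        gcongr
    _ = Real.exp (Real.pi * ‖μ‖) * (E * ‖h‖)
        * (weight z * ∫ t in (0 : ℝ)..1, (1 - t * ‖z‖)⁻¹) := by ring
    _ ≤ Real.exp (Real.pi * ‖μ‖) * (E * ‖h‖) * 2 := by
        refine mul_le_mul_of_nonneg_left hI ?_
        have := norm_nonneg h
        have : 0 < E := Real.exp_pos _
        positivity
    _ = _ := by ring

/-! ### The semigroup -/

/-- The analytic function `φ_t(z) / z`. -/
noncomputable def phiFactor (t : ℝ) (z : ℂ) : ℂ :=
  Real.exp (-t) / ((Real.exp (-t) - 1) * z + 1)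

theorem phi_eq (t : ℝ) (z : ℂ) : phi t z = z * phiFactor t z := by
  rw [phi, phiFactor]; ring

theorem semigroupOp_eq (t : ℝ) (f : ℂ → ℂ) (z : ℂ) :
    semigroupOp t f z = phiFactor t z * f (phi t z) := rfl

theorem phi_denom_bound {t : ℝ} (ht : 0 ≤ t) {z : ℂ} (hz : z ∈ disc) :
    Real.exp (-t) ≤ ‖((Real.exp (-t) : ℂ) - 1) * z + 1‖ ∧
      1 - ‖z‖ ≤ ‖((Real.exp (-t) : ℂ) - 1) * z + 1‖ := by
  have he1 : Real.exp (-t) ≤ 1 := Real.exp_le_one_iff.2 (by linarith)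
  have he0 := Real.exp_pos (-t)
  have hr := mem_disc.1 hz
  have hn : ‖((Real.exp (-t) : ℂ) - 1) * z‖ = (1 - Real.exp (-t)) * ‖z‖ := by
    rw [norm_mul, ← Complex.ofReal_one, ← Complex.ofReal_sub, Complex.norm_real, Real.norm_eq_abs,
      abs_sub_comm, abs_of_nonneg (by linarith)]
  have h1 : 1 - (1 - Real.exp (-t)) * ‖z‖ ≤ ‖((Real.exp (-t) : ℂ) - 1) * z + 1‖ := by
    have := norm_sub_norm_le (1 : ℂ) (-(((Real.exp (-t) : ℂ) - 1) * z))
    rwa [norm_neg, norm_one, hn, sub_neg_eq_add, add_comm (1 : ℂ)] at this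
  have hr0 := norm_nonneg z
  constructor
  · refine le_trans ?_ h1
    have := mul_le_of_le_one_right (sub_nonneg.2 he1) hr.le
    linarith
  · refine le_trans ?_ h1
    have := mul_nonneg he0.le hr0
    linarith

theorem phi_denom_ne_zero {t : ℝ} (ht : 0 ≤ t) {z : ℂ} (hz : z ∈ disc) :
    ((Real.exp (-t) : ℂ) - 1) * z + 1 ≠ 0 :=
  norm_pos_iff.1 ((Real.exp_pos _).trans_le (phi_denom_bound ht hz).1)

theorem norm_phiFactor_le_one {t : ℝ} (ht : 0 ≤ t) {z : ℂ} (hz : z ∈ disc) :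
    ‖phiFactor t z‖ ≤ 1 := by
  rw [phiFactor, norm_div, Complex.norm_real, Real.norm_of_nonneg (Real.exp_pos _).le]
  exact div_le_one_of_le₀ (phi_denom_bound ht hz).1 (norm_nonneg _)

theorem norm_phiFactor_le {t : ℝ} (ht : 0 ≤ t) {z : ℂ} (hz : z ∈ disc) :
    ‖phiFactor t z‖ ≤ (1 - ‖z‖)⁻¹ * Real.exp (-t) := by
  rw [phiFactor, norm_div, Complex.norm_real, Real.norm_of_nonneg (Real.exp_pos _).le,
    div_eq_inv_mul]
  exact mul_le_mul_of_nonneg_right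
    (inv_anti₀ (sub_pos.2 (mem_disc.1 hz)) (phi_denom_bound ht hz).2) (Real.exp_pos _).le

theorem norm_phi_le {t : ℝ} (ht : 0 ≤ t) {z : ℂ} (hz : z ∈ disc) : ‖phi t z‖ ≤ ‖z‖ := by
  rw [phi_eq, norm_mul]
  exact mul_le_of_le_one_right (norm_nonneg z) (norm_phiFactor_le_one ht hz)

theorem phi_mem_disc {t : ℝ} (ht : 0 ≤ t) {z : ℂ} (hz : z ∈ disc) : phi t z ∈ disc :=
  mem_disc.2 ((norm_phi_le ht hz).trans_lt (mem_disc.1 hz))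

theorem semigroupOp_zero (f : ℂ → ℂ) (z : ℂ) : semigroupOp 0 f z = f z := by
  simp [semigroupOp, phi]

theorem semigroupOp_add {s : ℝ} (hs : 0 ≤ s) (t : ℝ) (f : ℂ → ℂ) {z : ℂ}
    (hz : z ∈ disc) : semigroupOp (s + t) f z = semigroupOp s (semigroupOp t f) z := by
  have h1 := phi_denom_ne_zero hs hz
  have hfac : phiFactor (s + t) z = phiFactor s z * phiFactor t (phi s z) := by
    have key : (((Real.exp (-t) : ℂ) - 1) * phi s z + 1) * (((Real.exp (-s) : ℂ) - 1) * z + 1)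
        = ((Real.exp (-(s + t)) : ℂ) - 1) * z + 1 := by
      rw [phi, neg_add, Real.exp_add, Complex.ofReal_mul, add_mul, mul_assoc,
        div_mul_cancel₀ _ h1]
      ring
    rw [phiFactor, phiFactor, phiFactor, div_mul_div_comm, mul_comm (_ + 1) (_ + 1), key, neg_add,
      Real.exp_add, Complex.ofReal_mul]
  rw [semigroupOp_eq, semigroupOp_eq, semigroupOp_eq, phi_eq (s + t), hfac, phi_eq t, phi_eq s]
  ring_nf

theorem differentiableAt_phiFactor {t : ℝ} (ht : 0 ≤ t) {z : ℂ} (hz : z ∈ disc) :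
    DifferentiableAt ℂ (phiFactor t) z :=
  (differentiableAt_const _).div (by fun_prop) (phi_denom_ne_zero ht hz)

theorem semigroupOp_differentiableOn {t : ℝ} (ht : 0 ≤ t) {f : ℂ → ℂ}
    (hf : DifferentiableOn ℂ f disc) : DifferentiableOn ℂ (semigroupOp t f) disc := by
  have h1 : DifferentiableOn ℂ (phiFactor t) disc := fun z hz =>
    (differentiableAt_phiFactor ht hz).differentiableWithinAt
  have h2 : DifferentiableOn ℂ (phi t) disc := by
    rw [show phi t = fun z => z * phiFactor t z from funext (phi_eq t)]
    exact differentiableOn_id.mul h1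
  exact h1.mul (hf.comp h2 fun z hz => phi_mem_disc ht hz)

/-- `|φ_t(z)| ≤ |z|` and the weights are radially decreasing, so `S_t` is a contraction. -/
theorem weight_mul_semigroupOp_le {t : ℝ} (ht : 0 ≤ t) {k : ℕ+} (h : Step k) {z : ℂ}
    (hz : z ∈ disc) : weight z ^ (k : ℕ) * ‖semigroupOp t h z‖ ≤ ‖h‖ := by
  rw [semigroupOp_eq, norm_mul]
  have hp := phi_mem_disc ht hz
  have hw := (weight_pos hz).le
  calc weight z ^ (k : ℕ) * (‖phiFactor t z‖ * ‖h (phi t z)‖)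
      ≤ weight (phi t z) ^ (k : ℕ) * (1 * ‖h (phi t z)‖) := by
        gcongr
        · exact pow_nonneg (weight_pos hp).le _
        · exact weight_antitone hz (norm_phi_le ht hz)
        · exact norm_phiFactor_le_one ht hz
    _ ≤ ‖h‖ := by rw [one_mul]; exact h.weight_mul_norm_le hp

theorem phiFactor_hasDerivAt {t : ℝ} (ht : 0 ≤ t) {z : ℂ} (hz : z ∈ disc) :
    HasDerivAt (fun t : ℝ => phiFactor t z) (-(phiFactor t z * (1 - phi t z))) t := by
  have h0 := phi_denom_ne_zero ht hz
  have he : HasDerivAt (fun t : ℝ => (Real.exp (-t) : ℂ)) (-(Real.exp (-t) : ℂ)) t := by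
    have := ((hasDerivAt_neg t).exp).ofReal_comp
    simpa using this
  refine (he.div (((he.sub_const 1).mul_const z).add_const 1) h0).congr_deriv ?_
  rw [phi, phiFactor]
  generalize (Real.exp (-t) : ℂ) = e at *
  field_simp
  ring

/-- Along the semigroup, `d/dt (e^{μt} S_t K_μ h) = -e^{μt} S_t h`. -/
theorem hasDerivAt_exp_mul_semigroupOp {μ : ℂ} (hμ : μ.re ≤ 0) {h : ℂ → ℂ}
    (hh : DifferentiableOn ℂ h disc) {z : ℂ} (hz : z ∈ disc) {t : ℝ} (ht : 0 ≤ t) :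
    HasDerivAt (fun t : ℝ => Complex.exp (μ * t) * semigroupOp t (kernelOp μ h) z)
      (-(Complex.exp (μ * t) * semigroupOp t h z)) t := by
  have hp := phi_mem_disc ht hz
  have hc := phiFactor_hasDerivAt ht hz
  have hK := hasDerivAt_deriv_of_disc (kernelOp_differentiableOn hμ hh) hp
  have hphi : HasDerivAt (fun t : ℝ => phi t z) (z * -(phiFactor t z * (1 - phi t z))) t := by
    simp only [phi_eq _ z] at hc ⊢
    exact hc.const_mul z
  have hKc : HasDerivAt (fun t : ℝ => kernelOp μ h (phi t z))
      (deriv (kernelOp μ h) (phi t z) * (z * -(phiFactor t z * (1 - phi t z)))) t :=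
    HasDerivAt.comp (h₂ := kernelOp μ h) t hK hphi
  have hE : HasDerivAt (fun t : ℝ => Complex.exp (μ * t)) (Complex.exp (μ * t) * μ) t := by
    have : HasDerivAt (fun t : ℝ => μ * (t : ℂ)) μ t := by
      simpa using (Complex.ofRealCLM.hasDerivAt (x := t)).const_mul μ
    exact this.cexp
  refine (hE.mul (hc.mul hKc)).congr_deriv ?_
  have hode := kernelOp_ode hμ hh hp
  have e := phi_eq t z
  rw [semigroupOp_eq, Pi.mul_apply]
  linear_combination (-(Complex.exp (μ * t) * phiFactor t z)) * hode
    + (Complex.exp (μ * t) * phiFactor t z * (1 - phi t z)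
      * deriv (kernelOp μ h) (phi t z)) * e

theorem exists_semigroupOp_bound {h : ℂ → ℂ} (hh : DifferentiableOn ℂ h disc) {z : ℂ}
    (hz : z ∈ disc) :
    ∃ M : ℝ, ∀ t : ℝ, 0 ≤ t → ‖semigroupOp t h z‖ ≤ M * Real.exp (-t) := by
  have hsub : Metric.closedBall (0 : ℂ) ‖z‖ ⊆ disc := fun w hw =>
    mem_disc.2 ((mem_closedBall_zero_iff.1 hw).trans_lt (mem_disc.1 hz))
  obtain ⟨M, hM⟩ := (isCompact_closedBall (0 : ℂ) ‖z‖).exists_bound_of_continuousOn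
    (hh.continuousOn.mono hsub)
  refine ⟨(1 - ‖z‖)⁻¹ * M, fun t ht => ?_⟩
  have h1 := hM _ (mem_closedBall_zero_iff.2 (norm_phi_le ht hz))
  have h2 := norm_phiFactor_le ht hz
  rw [semigroupOp_eq, norm_mul, mul_right_comm]
  exact mul_le_mul h2 h1 (norm_nonneg _) ((norm_nonneg _).trans h2)

theorem norm_exp_mul_le_one {μ : ℂ} (hμ : μ.re ≤ 0) {t : ℝ} (ht : 0 ≤ t) :
    ‖Complex.exp (μ * t)‖ ≤ 1 := by
  rw [Complex.norm_exp, Complex.re_mul_ofReal]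
  exact Real.exp_le_one_iff.2 (mul_nonpos_of_nonpos_of_nonneg hμ ht)

/-- `K_μ h` is the Laplace transform of the orbit `S_t h`. -/
theorem kernelOp_eq_integral {μ : ℂ} (hμ : μ.re ≤ 0) {h : ℂ → ℂ}
    (hh : DifferentiableOn ℂ h disc) {z : ℂ} (hz : z ∈ disc) :
    MeasureTheory.IntegrableOn (fun t : ℝ => Complex.exp (μ * t) * semigroupOp t h z)
      (Set.Ioi 0) ∧
    kernelOp μ h z = ∫ t in Set.Ioi (0 : ℝ), Complex.exp (μ * t) * semigroupOp t h z := by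
  have hcont : ContinuousOn (fun t : ℝ => Complex.exp (μ * t) * semigroupOp t h z)
      (Set.Ioi 0) := by
    refine ContinuousOn.mul (by fun_prop) (ContinuousOn.mul (f := fun t => phiFactor t z) ?_ ?_)
    · exact fun t ht =>
        (phiFactor_hasDerivAt (le_of_lt ht) hz).continuousAt.continuousWithinAt
    · refine hh.continuousOn.comp (f := fun t => phi t z) ?_
        fun t ht => phi_mem_disc (le_of_lt ht) hz
      simp only [phi_eq]
      exact continuousOn_const.mul fun t ht =>
        (phiFactor_hasDerivAt (le_of_lt ht) hz).continuousAt.continuousWithinAt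
  have hbound : ∀ {g : ℂ → ℂ}, DifferentiableOn ℂ g disc → ∃ M : ℝ, ∀ t : ℝ, 0 ≤ t →
      ‖Complex.exp (μ * t) * semigroupOp t g z‖ ≤ M * Real.exp (-t) := fun hg => by
    obtain ⟨M, hM⟩ := exists_semigroupOp_bound hg hz
    refine ⟨M, fun t ht => ?_⟩
    rw [norm_mul]
    exact (mul_le_of_le_one_left (norm_nonneg _) (norm_exp_mul_le_one hμ ht)).trans (hM t ht)
  have hint : MeasureTheory.IntegrableOn
      (fun t : ℝ => Complex.exp (μ * t) * semigroupOp t h z) (Set.Ioi 0) := by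
    obtain ⟨M, hM⟩ := hbound hh
    refine MeasureTheory.Integrable.mono' ((integrableOn_exp_neg_Ioi 0).const_mul M)
      (hcont.aestronglyMeasurable measurableSet_Ioi) ?_
    refine (MeasureTheory.ae_restrict_iff' measurableSet_Ioi).2
      (Eventually.of_forall fun t ht => hM t (le_of_lt ht))
  refine ⟨hint, ?_⟩
  have hlim : Tendsto (fun t : ℝ => Complex.exp (μ * t) * semigroupOp t (kernelOp μ h) z)
      atTop (𝓝 0) := by
    obtain ⟨M, hM⟩ := hbound (kernelOp_differentiableOn hμ hh)
    have h0 : Tendsto (fun t : ℝ => M * Real.exp (-t)) atTop (𝓝 0) := by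
      simpa using (Real.tendsto_exp_neg_atTop_nhds_zero).const_mul M
    exact squeeze_zero_norm' (eventually_atTop.2 ⟨0, hM⟩) h0
  have := MeasureTheory.integral_Ioi_of_hasDerivAt_of_tendsto'
    (fun t ht => hasDerivAt_exp_mul_semigroupOp hμ hh hz ht) hint.neg hlim
  rw [MeasureTheory.integral_neg] at this
  simpa [semigroupOp_zero] using this.symm

theorem weight_mul_kernelOp_le_of_neg {μ : ℂ} (hμ : μ.re < 0) {k : ℕ+} (h : Step k) {z : ℂ}
    (hz : z ∈ disc) : weight z ^ (k : ℕ) * ‖kernelOp μ h z‖ ≤ |μ.re|⁻¹ * ‖h‖ := by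
  have hw := pow_pos (weight_pos hz) (k : ℕ)
  rw [(kernelOp_eq_integral hμ.le h.differentiableOn hz).2, ← Real.norm_of_nonneg hw.le,
    ← Complex.norm_real, ← norm_mul, ← MeasureTheory.integral_const_mul]
  have hi : ∫ t in Set.Ioi (0 : ℝ), Real.exp (μ.re * t) * ‖h‖ = |μ.re|⁻¹ * ‖h‖ := by
    rw [MeasureTheory.integral_mul_const, integral_exp_mul_Ioi hμ, mul_zero, Real.exp_zero,
      abs_of_neg hμ, neg_div, one_div, inv_neg]
  rw [← hi]
  refine MeasureTheory.norm_integral_le_of_norm_le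
    ((integrableOn_exp_mul_Ioi hμ 0).mul_const ‖h‖) ?_
  refine (MeasureTheory.ae_restrict_iff' measurableSet_Ioi).2 (Eventually.of_forall fun t ht => ?_)
  rw [norm_mul, norm_mul, Complex.norm_real, Real.norm_of_nonneg hw.le, Complex.norm_exp,
    Complex.re_mul_ofReal, mul_left_comm]
  exact mul_le_mul_of_nonneg_left (weight_mul_semigroupOp_le (le_of_lt ht) h hz) (Real.exp_pos _).le

/-! ### Injectivity -/

/-- The integrating factor `x^{1-μ} (1-x)^μ` on `(0, 1)` reduces the differential expression
`x (1-x) f' + (1-x) f - μ f` to a derivative. -/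
theorem hasDerivAt_integratingFactor (μ : ℂ) {f : ℂ → ℂ} (hf : DifferentiableOn ℂ f disc)
    {x : ℝ} (hx : x ∈ Set.Ioo (0 : ℝ) 1) :
    HasDerivAt (fun x : ℝ => (x : ℂ) ^ (1 - μ) * (1 - x : ℂ) ^ μ * f x)
      ((x : ℂ) ^ (-μ) * (1 - x : ℂ) ^ (μ - 1)
        * (x * (1 - x) * deriv f x + (1 - x) * f x - μ * f x)) x := by
  have hz : (x : ℂ) ∈ disc := by
    rw [mem_disc, Complex.norm_real, Real.norm_of_nonneg hx.1.le]; exact hx.2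
  have hx0 : (x : ℂ) ≠ 0 := Complex.ofReal_ne_zero.2 hx.1.ne'
  have h1 := one_sub_ne_zero hz
  have hd1 : HasDerivAt (fun z : ℂ => z ^ (1 - μ)) ((1 - μ) * (x : ℂ) ^ (1 - μ - 1)) x := by
    simpa using (hasDerivAt_id (x : ℂ)).cpow_const (c := 1 - μ)
      (Complex.ofReal_mem_slitPlane.2 hx.1)
  have key := ((hd1.mul (hasDerivAt_one_sub_cpow μ hz)).mul
    (hasDerivAt_deriv_of_disc hf hz)).comp_ofReal
  refine key.congr_deriv ?_
  have e1 : (x : ℂ) ^ (1 - μ) = x * (x : ℂ) ^ (-μ) := by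
    rw [sub_eq_add_neg, Complex.cpow_add _ _ hx0, Complex.cpow_one]
  have e2 : (1 - x : ℂ) ^ μ = (1 - x) * (1 - x : ℂ) ^ (μ - 1) := by
    rw [Complex.cpow_sub _ _ h1, Complex.cpow_one, mul_div_cancel₀ _ h1]
  have e3 : (1 - μ - 1 : ℂ) = -μ := by ring
  simp only [Pi.mul_apply]
  rw [e3, e1, e2]
  ring

theorem tendsto_integratingFactor_zero {μ : ℂ} {n : ℕ} (hn : μ.re < n + 1) {f g : ℂ → ℂ}
    (hg : DifferentiableOn ℂ g disc) (hfg : ∀ z ∈ disc, f z = z ^ n * g z) :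
    Tendsto (fun x : ℝ => (x : ℂ) ^ (1 - μ) * (1 - x : ℂ) ^ μ * f x) (𝓝[>] 0) (𝓝 0) := by
  have h0 : (0 : ℂ) ∈ disc := by simp [mem_disc]
  have hre : 0 < (n + 1 - μ).re := by simp; linarith
  have hne : (n + 1 - μ : ℂ) ≠ 0 := fun h => by rw [h] at hre; simp at hre
  have hc1 : ContinuousAt (fun x : ℝ => (x : ℂ) ^ (n + 1 - μ)) 0 :=
    (Complex.continuous_ofReal_cpow_const hre).continuousAt
  have hc2 : ContinuousAt (fun x : ℝ => (1 - x : ℂ) ^ μ) 0 :=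
    ContinuousAt.comp (g := fun z : ℂ => (1 - z) ^ μ) (f := fun x : ℝ => (x : ℂ)) (x := 0)
      (hasDerivAt_one_sub_cpow μ (by simpa using h0)).continuousAt
      Complex.continuous_ofReal.continuousAt
  have hc3 : ContinuousAt (fun x : ℝ => g x) 0 :=
    ContinuousAt.comp (g := g) (f := fun x : ℝ => (x : ℂ)) (x := 0)
      (hasDerivAt_deriv_of_disc hg (by simpa using h0)).continuousAt
      Complex.continuous_ofReal.continuousAt
  have hlim := ((hc1.mul hc2).mul hc3).tendsto
  have hval : ((0 : ℝ) : ℂ) ^ (n + 1 - μ) * (1 - ((0 : ℝ) : ℂ)) ^ μ * g ((0 : ℝ) : ℂ) = 0 := by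
    rw [Complex.ofReal_zero, Complex.zero_cpow hne, zero_mul, zero_mul]
  have hlim' := hlim.mono_left (nhdsWithin_le_nhds (s := Set.Ioi 0))
  simp only [Pi.mul_apply] at hlim'
  rw [hval] at hlim'
  refine hlim'.congr' ?_
  filter_upwards [Ioo_mem_nhdsGT (zero_lt_one (α := ℝ))] with x hx
  have hz : (x : ℂ) ∈ disc := by
    rw [mem_disc, Complex.norm_real, Real.norm_of_nonneg hx.1.le]; exact hx.2
  have hx0 : (x : ℂ) ≠ 0 := Complex.ofReal_ne_zero.2 hx.1.ne'
  have e : (x : ℂ) ^ (n + 1 - μ) = (x : ℂ) ^ n * (x : ℂ) ^ (1 - μ) := by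
    rw [← Complex.cpow_natCast, ← Complex.cpow_add _ _ hx0]
    ring_nf
  rw [hfg _ hz, Pi.mul_apply, Pi.mul_apply, e]
  ring

theorem tendsto_integratingFactor_one {μ : ℂ} (hμ : 0 < μ.re) (f : VH) :
    Tendsto (fun x : ℝ => (x : ℂ) ^ (1 - μ) * (1 - x : ℂ) ^ μ * f x) (𝓝[<] 1) (𝓝 0) := by
  have h1 := f.tendsto_rpow_mul_norm (w := 1) norm_one hμ
  have h2 : Tendsto (fun x : ℝ => ‖(x : ℂ) ^ (1 - μ)‖) (𝓝[<] 1) (𝓝 1) := by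
    have : ContinuousAt (fun x : ℝ => (x : ℂ) ^ (1 - μ)) 1 :=
      Complex.continuousAt_ofReal_cpow_const 1 _ (Or.inr one_ne_zero)
    simpa using (this.norm.tendsto).mono_left (nhdsWithin_le_nhds (s := Set.Iio 1))
  refine tendsto_zero_iff_norm_tendsto_zero.2 ?_
  have h3 := h2.mul h1
  rw [mul_zero] at h3
  refine h3.congr' ?_
  filter_upwards [self_mem_nhdsWithin] with x hx
  have hx : 0 < 1 - x := sub_pos.2 (Set.mem_Iio.1 hx)
  have e : ‖(1 - x : ℂ) ^ μ‖ = (1 - x) ^ μ.re := by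
    rw [← Complex.norm_cpow_eq_rpow_re_of_pos hx, Complex.ofReal_sub, Complex.ofReal_one]
  rw [norm_mul, norm_mul, e, mul_one, mul_assoc]

/-- A function in `VH(𝔻)` that vanishes on the segment `(0, 1)` vanishes. -/
theorem VH.eq_zero_of_eqOn_Ioo (f : VH) (h : ∀ x ∈ Set.Ioo (0 : ℝ) 1, f x = 0) : f = 0 := by
  refine VH.ext_disc fun z hz => ?_
  have ha : AnalyticOnNhd ℂ f disc := f.differentiableOn.analyticOnNhd isOpen_disc
  have hzero : ∃ᶠ w in 𝓝[≠] (0 : ℂ), f w = 0 := by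
    have ht : Tendsto (fun x : ℝ => (x : ℂ)) (𝓝[>] 0) (𝓝[≠] 0) := by
      refine tendsto_nhdsWithin_iff.2 ⟨?_, ?_⟩
      · have := Complex.continuous_ofReal.tendsto 0
        rw [Complex.ofReal_zero] at this
        exact this.mono_left nhdsWithin_le_nhds
      · filter_upwards [self_mem_nhdsWithin] with x hx
        exact Complex.ofReal_ne_zero.2 (ne_of_gt hx)
    refine ht.frequently (Eventually.frequently ?_)
    filter_upwards [Ioo_mem_nhdsGT (zero_lt_one (α := ℝ))] with x hx using h x hx
  exact ha.eqOn_zero_of_preconnected_of_frequently_eq_zero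
    (convex_ball (0 : ℂ) 1).isPreconnected (by simp [mem_disc]) hzero hz

/-- The differential form of the equation `λ f - C f = h`. -/
theorem ode_of_smul_sub {lam : ℂ} {f h : ℂ → ℂ} (hf : DifferentiableOn ℂ f disc)
    (he : ∀ z ∈ disc, lam * f z - kernelOp 0 f z = h z) {z : ℂ} (hz : z ∈ disc) :
    lam * (z * (1 - z) * deriv f z + (1 - z) * f z) - f z
      = z * (1 - z) * deriv h z + (1 - z) * h z := by
  have hd1 := ((hasDerivAt_deriv_of_disc hf hz).const_mul lam).sub
    (hasDerivAt_deriv_of_disc (kernelOp_differentiableOn (μ := 0) le_rfl hf) hz)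
  have hE : (fun z => lam * f z - kernelOp 0 f z) =ᶠ[𝓝 z] h :=
    Filter.mem_of_superset (isOpen_disc.mem_nhds hz) he
  have hd2 := (hd1.congr_of_eventuallyEq hE.symm).deriv
  have hode := kernelOp_ode (μ := 0) le_rfl hf hz
  have h0 := he z hz
  rw [hd2, ← h0]
  linear_combination hode

/-- On `(0, 1)` an eigenfunction is a multiple of `x^{μ-1} (1-x)^{-μ}`, `μ = 1/λ`, which is not
bounded near `0` unless `Re μ ≥ 1` and not of logarithmic growth near `1` unless `Re μ ≤ 0`. -/
theorem VH.eq_zero_of_eigen {lam : ℂ} (f : VH)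
    (he : ∀ z ∈ disc, lam * f z - kernelOp 0 f z = 0) : f = 0 := by
  have hode := fun z (hz : z ∈ disc) => ode_of_smul_sub (h := fun _ => 0) f.differentiableOn he hz
  simp only [deriv_const, mul_zero, add_zero] at hode
  rcases eq_or_ne lam 0 with rfl | hlam
  · exact VH.ext_disc fun z hz => by
      have := hode z hz
      rw [zero_mul, zero_sub, neg_eq_zero] at this
      exact this
  set μ := lam⁻¹ with hμ
  set p : ℝ → ℂ := fun x => (x : ℂ) ^ (1 - μ) * (1 - x : ℂ) ^ μ * f x with hp
  have hdisc : ∀ x ∈ Set.Ioo (0 : ℝ) 1, (x : ℂ) ∈ disc := fun x hx => by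
    rw [mem_disc, Complex.norm_real, Real.norm_of_nonneg hx.1.le]; exact hx.2
  have hd : ∀ x ∈ Set.Ioo (0 : ℝ) 1, HasDerivAt p 0 x := fun x hx => by
    refine (hasDerivAt_integratingFactor μ f.differentiableOn hx).congr_deriv ?_
    have h := hode x (hdisc x hx)
    have : (x * (1 - x) * deriv f x + (1 - x) * f x - μ * f x : ℂ) = 0 := by
      have hl : μ * lam = 1 := inv_mul_cancel₀ hlam
      linear_combination μ * h - (x * (1 - x) * deriv f x + (1 - x) * f x) * hl
    rw [this, mul_zero]
  have hconst : ∀ x ∈ Set.Ioo (0 : ℝ) 1, ∀ y ∈ Set.Ioo (0 : ℝ) 1, p x = p y := fun x hx y hy =>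
    isOpen_Ioo.is_const_of_deriv_eq_zero isPreconnected_Ioo
      (fun w hw => (hd w hw).differentiableAt.differentiableWithinAt)
      (fun w hw => (hd w hw).deriv) hx hy
  have hp0 : ∀ x ∈ Set.Ioo (0 : ℝ) 1, p x = 0 := by
    intro x hx
    rcases lt_or_ge 0 μ.re with hre | hre
    · refine tendsto_nhds_unique (f := p) (l := 𝓝[<] 1) ?_ (tendsto_integratingFactor_one hre f)
      refine tendsto_const_nhds.congr' ?_
      filter_upwards [Ioo_mem_nhdsLT (zero_lt_one (α := ℝ))] with y hy using hconst x hx y hy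
    · refine tendsto_nhds_unique (f := p) (l := 𝓝[>] 0) ?_ (tendsto_integratingFactor_zero (n := 0)
        (by rw [Nat.cast_zero]; linarith) f.differentiableOn fun z _ => by rw [pow_zero, one_mul])
      refine tendsto_const_nhds.congr' ?_
      filter_upwards [Ioo_mem_nhdsGT (zero_lt_one (α := ℝ))] with y hy using hconst x hx y hy
  refine f.eq_zero_of_eqOn_Ioo fun x hx => ?_
  have hx0 : (x : ℂ) ≠ 0 := Complex.ofReal_ne_zero.2 hx.1.ne'
  have := hp0 x hx
  simp only [hp, mul_eq_zero] at this
  rcases this with (h | h) | h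
  · exact absurd ((Complex.cpow_eq_zero_iff _ _).1 h).1 hx0
  · exact absurd ((Complex.cpow_eq_zero_iff _ _).1 h).1 (one_sub_ne_zero (hdisc x hx))
  · exact h

/-! ### Failure of surjectivity -/

theorem VH.exists_of_bound {k : ℕ+} {u : ℂ → ℂ} {M : ℝ} (hu : DifferentiableOn ℂ u disc)
    (hM : ∀ z ∈ disc, weight z ^ (k : ℕ) * ‖u z‖ ≤ M) : ∃ g : VH, ∀ z ∈ disc, g z = u z := by
  obtain ⟨g, hg, -⟩ := Step.exists_of_bound hu hM
  exact ⟨incl k g, hg⟩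

theorem VH.exists_pow (n : ℕ) : ∃ g : VH, ∀ z ∈ disc, g z = z ^ n := by
  refine VH.exists_of_bound (k := 1) (M := 1) (differentiableOn_pow n) fun z hz => ?_
  rw [PNat.one_coe, pow_one, norm_pow]
  exact mul_le_one₀ (weight_le_one hz) (by positivity)
    (pow_le_one₀ (norm_nonneg z) (mem_disc.1 hz).le)

/-- `C` is not onto: the reflection `g(z) = (C 1)(-z)` of `C 1` belongs to `VH(𝔻)`, but
`C f = g` forces `f(z) = (1 - z) / (1 + z)`. -/
theorem exists_notMem_range_kernelOp_zero :
    ∃ g : VH, ∀ f : VH, ¬ ∀ z ∈ disc, (0 : ℂ) * f z - kernelOp 0 f z = g z := by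
  obtain ⟨one, hone⟩ := VH.exists_pow 0
  obtain ⟨k, o, rfl⟩ := one.exists_incl
  have ho : ∀ z ∈ disc, o z = 1 := fun z hz => (hone z hz).trans (pow_zero z)
  have hdiff : DifferentiableOn ℂ (fun z => kernelOp 0 o (-z)) disc :=
    (kernelOp_differentiableOn (μ := 0) le_rfl o.differentiableOn).comp
      (differentiableOn_neg disc) fun z hz => neg_mem_disc hz
  obtain ⟨g, hg⟩ := VH.exists_of_bound (k := k + 1) hdiff fun z hz => by
    rw [← weight_neg]
    exact weight_mul_kernelOp_le (μ := 0) rfl o (neg_mem_disc hz)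
  refine ⟨g, fun f hf => ?_⟩
  have hfz : ∀ z ∈ disc, (1 + z) * f z = -(1 - z) := fun z hz => by
    have hnz := neg_mem_disc hz
    have h1 := ode_of_smul_sub f.differentiableOn
      (fun z hz => (hf z hz).trans (hg z hz)) hz
    have h2 := kernelOp_ode (μ := 0) le_rfl o.differentiableOn hnz
    rw [deriv_comp_neg] at h1
    rw [ho _ hnz] at h2
    linear_combination -(1 + z) * h1 - (1 - z) * h2
  have hlim := f.tendsto_rpow_mul_norm (w := -1) (by simp) zero_lt_one
  have hlim2 : Tendsto (fun x : ℝ => 1 + x) (𝓝[<] 1) (𝓝 (1 + 1)) :=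
    ((continuous_const.add continuous_id).tendsto (1 : ℝ)).mono_left nhdsWithin_le_nhds
  have : (1 + 1 : ℝ) = 0 := by
    refine tendsto_nhds_unique (hlim2.congr' ?_) hlim
    filter_upwards [Ioo_mem_nhdsLT (zero_lt_one (α := ℝ))] with x hx
    have hz : (x : ℂ) * -1 ∈ disc := by
      rw [mem_disc, norm_mul, Complex.norm_real, Real.norm_of_nonneg hx.1.le]
      simpa using hx.2
    have e := congrArg norm (hfz _ hz)
    have e1 : (1 + (x : ℂ) * -1) = ((1 - x : ℝ) : ℂ) := by push_cast; ring
    have e2 : (1 - (x : ℂ) * -1) = ((1 + x : ℝ) : ℂ) := by push_cast; ring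
    rw [norm_mul, norm_neg, e1, e2, Complex.norm_real, Complex.norm_real,
      Real.norm_of_nonneg (sub_nonneg.2 hx.2.le), Real.norm_of_nonneg (by linarith [hx.1])] at e
    rw [Real.rpow_one, e]
  norm_num at this

/-- If `f(z) = z^j g(z)` then the equation for `f` with right-hand side `z^n`, `j ≤ n`, can be
divided by `z^j`. -/
theorem ode_div_pow {lam : ℂ} {n j : ℕ} (hj : j ≤ n) {f g : ℂ → ℂ}
    (hf : DifferentiableOn ℂ f disc) (hg : DifferentiableOn ℂ g disc)
    (hfg : ∀ z ∈ disc, f z = z ^ j * g z)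
    (he : ∀ z ∈ disc, lam * f z - kernelOp 0 f z = z ^ n) {z : ℂ} (hz : z ∈ disc) :
    lam * (1 - z) * ((j + 1) * g z + z * deriv g z) - g z = (n + 1) * z ^ (n - j) * (1 - z) := by
  have hg' := continuousOn_deriv_of_disc hg
  -- The equation holds off the origin and extends by continuity.
  have hE : ∀ z ∈ disc, z ≠ 0 → lam * (1 - z) * ((j + 1) * g z + z * deriv g z) - g z
      - (n + 1) * z ^ (n - j) * (1 - z) = 0 := fun z hz hz0 => by
    have hode := ode_of_smul_sub hf he hz
    have hd : deriv f z = j * z ^ (j - 1) * g z + z ^ j * deriv g z := by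
      have h1 := (hasDerivAt_pow j z).mul (hasDerivAt_deriv_of_disc hg hz)
      exact (h1.congr_of_eventuallyEq
        (Filter.mem_of_superset (isOpen_disc.mem_nhds hz) hfg)).deriv
    have e1 : ∀ m : ℕ, (m : ℂ) * (z * z ^ (m - 1)) = m * z ^ m := fun m => by
      cases m with
      | zero => simp
      | succ m => rw [Nat.add_sub_cancel, pow_succ']
    have e2 : z ^ n = z ^ j * z ^ (n - j) := by rw [← pow_add, Nat.add_sub_cancel' hj]
    have hdn : deriv (fun z : ℂ => z ^ n) z = n * z ^ (n - 1) := (hasDerivAt_pow n z).deriv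
    rw [hd, hdn, hfg z hz] at hode
    refine (mul_eq_zero.1 ?_).resolve_left (pow_ne_zero j hz0)
    linear_combination hode - lam * (1 - z) * g z * e1 j + (1 - z) * e1 n + (n + 1) * (1 - z) * e2
  rcases eq_or_ne z 0 with rfl | hz0
  · have hc : ContinuousAt (fun z : ℂ => lam * (1 - z) * ((j + 1) * g z + z * deriv g z) - g z
        - (n + 1) * z ^ (n - j) * (1 - z)) 0 := by
      have h1 := hg.continuousOn.continuousAt (isOpen_disc.mem_nhds hz)
      have h2 := hg'.continuousAt (isOpen_disc.mem_nhds hz)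
      fun_prop
    refine sub_eq_zero.1 (tendsto_nhds_unique (hc.tendsto.mono_left
      (nhdsWithin_le_nhds (s := {0}ᶜ))) (tendsto_const_nhds.congr' ?_))
    filter_upwards [self_mem_nhdsWithin, mem_nhdsWithin_of_mem_nhds (isOpen_disc.mem_nhds hz)]
      with w hw hwd using (hE w hwd hw).symm
  · exact sub_eq_zero.1 (hE z hz hz0)

/-- Comparison of Taylor coefficients: if `λ f - C f = z^n` and `λ` is none of
`1, 1/2, …, 1/n`, then `f` vanishes to order `n` at the origin. -/
theorem exists_eq_pow_mul {lam : ℂ} {n : ℕ} (hlam : ∀ j < n, lam * (j + 1) ≠ 1) {f : ℂ → ℂ}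
    (hf : DifferentiableOn ℂ f disc)
    (he : ∀ z ∈ disc, lam * f z - kernelOp 0 f z = z ^ n) :
    ∀ j ≤ n, ∃ g, DifferentiableOn ℂ g disc ∧ ∀ z ∈ disc, f z = z ^ j * g z := by
  have h0 : (0 : ℂ) ∈ disc := by simp [mem_disc]
  intro j
  induction j with
  | zero => exact fun _ => ⟨f, hf, fun z _ => by rw [pow_zero, one_mul]⟩
  | succ j ih =>
    intro hj
    obtain ⟨g, hg, hfg⟩ := ih (by omega)
    have hg0 : g 0 = 0 := by
      have h := ode_div_pow (by omega) hf hg hfg he h0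
      rw [zero_pow (by omega : n - j ≠ 0)] at h
      refine (mul_eq_zero.1 ?_).resolve_left (sub_ne_zero.2 (hlam j (by omega)))
      linear_combination h
    refine ⟨dslope g 0, (Complex.differentiableOn_dslope (isOpen_disc.mem_nhds h0)).2 hg,
      fun z hz => ?_⟩
    have := sub_smul_dslope g 0 z
    rw [sub_zero, hg0, sub_zero, smul_eq_mul] at this
    rw [hfg z hz, ← this, pow_succ, mul_assoc]

/-- For `Re λ > 0` some monomial `z^n` is not in the range of `λ - C`: if `λ = 1/(n+1)` for some
`n`, this is seen from the coefficient of `z^n`; otherwise the integrating factor turns the equation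
into the vanishing of the beta integral `B(n + 1 - μ, 1 + μ)`, `μ = 1/λ`, `n > Re μ`. -/
theorem exists_notMem_range {lam : ℂ} (hlam : 0 < lam.re) :
    ∃ g : VH, ∀ f : VH, ¬ ∀ z ∈ disc, lam * f z - kernelOp 0 f z = g z := by
  have h0 : (0 : ℂ) ∈ disc := by simp [mem_disc]
  have hl0 : lam ≠ 0 := fun h => by rw [h] at hlam; simp at hlam
  suffices ∃ n : ℕ, ∀ f : VH, ¬ ∀ z ∈ disc, lam * f z - kernelOp 0 f z = z ^ n by
    obtain ⟨n, hn⟩ := this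
    obtain ⟨g, hg⟩ := VH.exists_pow n
    exact ⟨g, fun f hf => hn f fun z hz => (hf z hz).trans (hg z hz)⟩
  by_cases hm : ∃ m : ℕ, lam * (m + 1) = 1
  · obtain ⟨m, hm⟩ := hm
    refine ⟨m, fun f hf => ?_⟩
    have hne : ∀ j < m, lam * (j + 1) ≠ 1 := fun j hj h => by
      have := mul_left_cancel₀ hl0 (h.trans hm.symm)
      have := Nat.cast_injective (R := ℂ) (add_right_cancel this)
      omega
    obtain ⟨g, hg, hfg⟩ := exists_eq_pow_mul hne f.differentiableOn hf m le_rfl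
    have h := ode_div_pow le_rfl f.differentiableOn hg hfg hf h0
    rw [Nat.sub_self, pow_zero] at h
    have : (m + 1 : ℂ) = 0 := by linear_combination -h + g 0 * hm
    exact Nat.cast_add_one_ne_zero m this
  · have hne : ∀ m : ℕ, lam * (m + 1) ≠ 1 := fun m h => hm ⟨m, h⟩
    set μ := lam⁻¹ with hμ
    have hμl : μ * lam = 1 := inv_mul_cancel₀ hl0
    have hμre : 0 < μ.re := by
      rw [hμ, Complex.inv_re]
      exact div_pos hlam (Complex.normSq_pos.2 hl0)
    obtain ⟨n, hn⟩ := exists_nat_gt μ.re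
    have hn1 : μ.re < n + 1 := by linarith
    refine ⟨n, fun f hf => ?_⟩
    obtain ⟨g, hg, hfg⟩ := exists_eq_pow_mul (fun j _ => hne j) f.differentiableOn hf n le_rfl
    have hre1 : 0 < (n + 1 - μ).re := by simp; linarith
    have hre2 : 0 < (1 + μ).re := by simp; linarith
    have hder : ∀ x ∈ Set.Ioo (0 : ℝ) 1, HasDerivAt
        (fun x : ℝ => (x : ℂ) ^ (1 - μ) * (1 - x : ℂ) ^ μ * f x)
        (μ * (n + 1) * ((x : ℂ) ^ ((n + 1 - μ) - 1) * (1 - x : ℂ) ^ ((1 + μ) - 1))) x := by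
      intro x hx
      have hz : (x : ℂ) ∈ disc := by
        rw [mem_disc, Complex.norm_real, Real.norm_of_nonneg hx.1.le]; exact hx.2
      have hx0 : (x : ℂ) ≠ 0 := Complex.ofReal_ne_zero.2 hx.1.ne'
      have h1 := one_sub_ne_zero hz
      refine (hasDerivAt_integratingFactor μ f.differentiableOn hx).congr_deriv ?_
      have hode := ode_of_smul_sub f.differentiableOn hf hz
      have hdn : deriv (fun z : ℂ => z ^ n) (x : ℂ) = n * (x : ℂ) ^ (n - 1) :=
        (hasDerivAt_pow n (x : ℂ)).deriv
      have e1 : (n : ℂ) * (x * (x : ℂ) ^ (n - 1)) = n * (x : ℂ) ^ n := by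
        cases n with
        | zero => simp
        | succ m => rw [Nat.add_sub_cancel, pow_succ']
      have e2 : (x * (1 - x) * deriv f x + (1 - x) * f x - μ * f x : ℂ)
          = μ * (n + 1) * ((x : ℂ) ^ n * (1 - x)) := by
        rw [hdn] at hode
        linear_combination μ * hode - (x * (1 - x) * deriv f x + (1 - x) * f x) * hμl
          + μ * (1 - x) * e1
      have e3 : (x : ℂ) ^ ((n + 1 - μ) - 1) = (x : ℂ) ^ n * (x : ℂ) ^ (-μ) := by
        rw [← Complex.cpow_natCast, ← Complex.cpow_add _ _ hx0]
        ring_nf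
      have e4 : (1 - x : ℂ) ^ ((1 + μ) - 1) = (1 - x) * (1 - x : ℂ) ^ (μ - 1) := by
        rw [add_sub_cancel_left, Complex.cpow_sub _ _ h1, Complex.cpow_one, mul_div_cancel₀ _ h1]
      rw [e2, e3, e4]
      ring
    have hint := (Complex.betaIntegral_convergent hre1 hre2).const_mul (μ * (n + 1))
    have key := intervalIntegral.integral_eq_sub_of_hasDerivAt_of_tendsto zero_lt_one hder hint
      (tendsto_integratingFactor_zero hn1 hg hfg) (tendsto_integratingFactor_one hμre f)
    rw [intervalIntegral.integral_const_mul, sub_zero] at key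
    have hμ0 : μ ≠ 0 := inv_ne_zero hl0
    have hbeta : Complex.betaIntegral (n + 1 - μ) (1 + μ) = 0 :=
      (mul_eq_zero.1 key).resolve_left (mul_ne_zero hμ0 (Nat.cast_add_one_ne_zero n))
    have hG := Complex.Gamma_mul_Gamma_eq_betaIntegral hre1 hre2
    rw [hbeta, mul_zero] at hG
    exact mul_ne_zero (Complex.Gamma_ne_zero_of_re_pos hre1)
      (Complex.Gamma_ne_zero_of_re_pos hre2) hG

/-! ### The resolvent -/

theorem cesaro_congr {f g : ℂ → ℂ} (h : ∀ z ∈ disc, f z = g z) {z : ℂ} (hz : z ∈ disc) :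
    cesaro f z = cesaro g z := by
  have h0 : (0 : ℂ) ∈ disc := by simp [mem_disc]
  have e : ∫ t in (0 : ℝ)..1, f (t * z) / (1 - t * z)
      = ∫ t in (0 : ℝ)..1, g (t * z) / (1 - t * z) :=
    intervalIntegral.integral_congr fun t ht => by
      rw [Set.uIcc_of_le zero_le_one] at ht
      simp only [h _ (smul_mem_disc hz ht)]
  simp only [cesaro, segmentIntegral, h 0 h0, e]

/-- The estimates for `K_μ` on the steps make it a continuous operator, which is then the main
part of the resolvent. -/
theorem VH.isUnit_and_resolvent {T : VH →L[ℂ] VH}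
    (hT : ∀ f : VH, ∀ z ∈ disc, T f z = kernelOp 0 f z) {lam : ℂ} (hlam : lam ≠ 0)
    (hμ : lam⁻¹.re ≤ 0) (l : ℕ+ → ℕ+) (M : ℕ+ → ℝ)
    (hb : ∀ k (h : Step k), ∀ z ∈ disc, weight z ^ (l k : ℕ) * ‖kernelOp lam⁻¹ h z‖ ≤ M k * ‖h‖) :
    IsUnit (algebraMap ℂ (VH →L[ℂ] VH) lam - T) ∧
      ∀ h : VH, ∀ z ∈ disc,
        resolvent T lam h z = lam⁻¹ * h z + lam⁻¹ ^ 2 * kernelOp lam⁻¹ h z := by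
  obtain ⟨K, hK⟩ := VH.exists_operator (kernelOp lam⁻¹) l M
    (fun f g z hz => kernelOp_add hμ f.differentiableOn g.differentiableOn hz)
    (fun c f z _ => kernelOp_const_mul _ c f z)
    (fun f => kernelOp_differentiableOn hμ f.differentiableOn) hb
  set A : VH →L[ℂ] VH := algebraMap ℂ (VH →L[ℂ] VH) lam - T with hA
  have hAz : ∀ f : VH, ∀ z ∈ disc, A f z = lam * f z - kernelOp 0 f z := fun f z hz => by
    rw [← hT f z hz]
    rfl
  have hinj : ∀ f : VH, A f = 0 → f = 0 := fun f hf =>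
    f.eq_zero_of_eigen fun z hz => by rw [← hAz f z hz, hf, VH.zero_apply]
  let R : VH →L[ℂ] VH := lam⁻¹ • ContinuousLinearMap.id ℂ VH + lam⁻¹ ^ 2 • K
  have hR : ∀ f : VH, ∀ z ∈ disc, R f z = lam⁻¹ * f z + lam⁻¹ ^ 2 * kernelOp lam⁻¹ f z :=
    fun f z hz => by
      rw [← hK f z hz]
      rfl
  have hright : A * R = 1 := by
    refine ContinuousLinearMap.ext fun f => VH.ext_disc fun z hz => ?_
    have hKf : T (K f) z = kernelOp 0 (kernelOp lam⁻¹ f) z := by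
      rw [hT _ z hz, ← cesaro_eq_kernelOp, ← cesaro_eq_kernelOp]
      exact cesaro_congr (hK f) hz
    have e : (A * R) f z
        = lam * R f z - (lam⁻¹ * T f z + lam⁻¹ ^ 2 * T (K f) z) := by
      have : (A * R) f = lam • R f - (lam⁻¹ • T f + lam⁻¹ ^ 2 • T (K f)) := by
        have hTR : T (R f) = lam⁻¹ • T f + lam⁻¹ ^ 2 • T (K f) := by
          change T (lam⁻¹ • f + lam⁻¹ ^ 2 • K f) = _
          rw [map_add, map_smul, map_smul]
        rw [← hTR]
        rfl
      rw [this]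
      rfl
    have h1 := kernelOp_sub_kernelOp_zero hμ f.differentiableOn hz
    rw [e, hKf, hT f z hz, hR f z hz]
    change _ = f z
    have hl : lam * lam⁻¹ = 1 := mul_inv_cancel₀ hlam
    linear_combination (f z + lam⁻¹ * kernelOp lam⁻¹ f z) * hl + lam⁻¹ * h1
  have hleft : R * A = 1 := by
    refine ContinuousLinearMap.ext fun f => sub_eq_zero.1 (hinj _ ?_)
    have : A (R (A f)) = A f := congrArg (fun B : VH →L[ℂ] VH => B (A f)) hright
    rw [map_sub]
    exact sub_eq_zero.2 this
  let U : (VH →L[ℂ] VH)ˣ := ⟨A, R, hright, hleft⟩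
  refine ⟨⟨U, rfl⟩, fun h z hz => ?_⟩
  have : resolvent T lam = R := Ring.inverse_unit U
  rw [this, hR h z hz]

theorem inv_re_eq_zero {lam : ℂ} (h : lam.re = 0) : lam⁻¹.re = 0 := by
  rw [Complex.inv_re, h, zero_div]

theorem inv_re_neg {lam : ℂ} (h : lam.re < 0) : lam⁻¹.re < 0 := by
  rw [Complex.inv_re]
  refine div_neg_of_neg_of_pos h (Complex.normSq_pos.2 fun h0 => ?_)
  rw [h0] at h
  exact lt_irrefl _ h

theorem sq_norm_mul_inv_abs_inv_re {lam : ℂ} (h : lam.re < 0) :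
    ‖lam⁻¹‖ ^ 2 * |lam⁻¹.re|⁻¹ = 1 / |lam.re| := by
  have h0 : lam ≠ 0 := fun h0 => by rw [h0] at h; exact lt_irrefl _ h
  have hn := (Complex.normSq_pos.2 h0)
  have hr : |lam.re| ≠ 0 := abs_ne_zero.2 h.ne
  rw [Complex.sq_norm, Complex.normSq_inv, Complex.inv_re, abs_div, abs_of_pos hn]
  field_simp

/-- For `t > 0` the principal power of `tz` splits as `(tz)^c = t^c z^c`. -/
theorem resolventIntegrand_eq {lam : ℂ} (h : ℂ → ℂ) {z : ℂ} (hz : z ≠ 0) {t : ℝ} (ht : 0 < t) :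
    resolventIntegrand lam h (t * z)
      = z ^ (-lam⁻¹) * ((t : ℂ) ^ (-lam⁻¹) * ((1 - t * z) ^ (lam⁻¹ - 1) * h (t * z))) := by
  have ht0 : (t : ℂ) ≠ 0 := Complex.ofReal_ne_zero.2 ht.ne'
  have e : ((t : ℂ) * z) ^ (-lam⁻¹) = (t : ℂ) ^ (-lam⁻¹) * z ^ (-lam⁻¹) := by
    rw [Complex.cpow_def_of_ne_zero (mul_ne_zero ht0 hz), Complex.cpow_def_of_ne_zero ht0,
      Complex.cpow_def_of_ne_zero hz, Complex.log_ofReal_mul ht hz, ← Complex.exp_add,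
      Complex.ofReal_log ht.le]
    ring_nf
  rw [resolventIntegrand, neg_div, one_div, e]
  ring

theorem kernelOp_eq_segmentIntegral {lam : ℂ} (hμ : lam⁻¹.re ≤ 0) {h : ℂ → ℂ}
    (hh : DifferentiableOn ℂ h disc) {z : ℂ} (hz : z ∈ disc) (hz0 : z ≠ 0) :
    IntervalIntegrable (fun t : ℝ => resolventIntegrand lam h (t * z)) MeasureTheory.volume 0 1 ∧
      z ^ (1 / lam - 1) * (1 - z) ^ (-1 / lam) * segmentIntegral (resolventIntegrand lam h) z
        = kernelOp lam⁻¹ h z := by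
  have heq : Set.EqOn (fun t : ℝ => z ^ (-lam⁻¹)
      * ((t : ℂ) ^ (-lam⁻¹) * ((1 - t * z) ^ (lam⁻¹ - 1) * h (t * z))))
      (fun t : ℝ => resolventIntegrand lam h (t * z)) (Set.uIoc 0 1) := fun t ht => by
    rw [Set.uIoc_of_le zero_le_one] at ht
    exact (resolventIntegrand_eq h hz0 ht.1).symm
  have hint := (intervalIntegrable_radial (a := -lam⁻¹) (by simp at hμ ⊢; linarith)
    (differentiableOn_one_sub_cpow_mul (lam⁻¹ - 1) hh).continuousOn hz).const_mul (z ^ (-lam⁻¹))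
  refine ⟨hint.congr heq, ?_⟩
  have hI : ∫ t in (0 : ℝ)..1, resolventIntegrand lam h (t * z)
      = z ^ (-lam⁻¹) * radialAverage (-lam⁻¹) (fun ζ => (1 - ζ) ^ (lam⁻¹ - 1) * h ζ) z := by
    rw [radialAverage, ← intervalIntegral.integral_const_mul]
    exact (intervalIntegral.integral_congr_ae (Eventually.of_forall heq)).symm
  have e : z ^ (lam⁻¹ - 1) * z * z ^ (-lam⁻¹) = 1 := by
    rw [Complex.cpow_sub _ _ hz0, Complex.cpow_one, div_mul_cancel₀ _ hz0,
      ← Complex.cpow_add _ _ hz0, add_neg_cancel, Complex.cpow_zero]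
  rw [segmentIntegral, hI, kernelOp, neg_div, one_div]
  linear_combination ((1 - z) ^ (-lam⁻¹)
    * radialAverage (-lam⁻¹) (fun ζ => (1 - ζ) ^ (lam⁻¹ - 1) * h ζ) z) * e

/-- A pointwise estimate for `K_μ h` gives an estimate for `μ h + μ² K_μ h` in `H^∞_{v_l}`. -/
theorem exists_step_resolvent {k l : ℕ+} (hkl : k ≤ l) {μ : ℂ} (hμ : μ.re ≤ 0) {B : ℝ}
    (h : Step k) (hB : ∀ z ∈ disc, weight z ^ (l : ℕ) * ‖kernelOp μ h z‖ ≤ B * ‖h‖) {r : VH}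
    (hr : ∀ z ∈ disc, r z = μ * h z + μ ^ 2 * kernelOp μ h z) :
    ∃ g : Step l, VH.incl l g = r ∧ ‖g‖ ≤ (‖μ‖ + ‖μ‖ ^ 2 * B) * ‖h‖ := by
  have hd : DifferentiableOn ℂ (fun z => μ * h z + μ ^ 2 * kernelOp μ h z) disc :=
    (h.differentiableOn.const_mul μ).add
      ((kernelOp_differentiableOn hμ h.differentiableOn).const_mul (μ ^ 2))
  obtain ⟨g, hg, hM⟩ := Step.exists_of_bound (k := l) hd (M := (‖μ‖ + ‖μ‖ ^ 2 * B) * ‖h‖)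
    fun z hz => by
      have hw := weight_pos hz
      have h1 : weight z ^ (l : ℕ) * ‖h z‖ ≤ ‖h‖ :=
        le_trans (mul_le_mul_of_nonneg_right
          (pow_le_pow_of_le_one hw.le (weight_le_one hz) hkl) (norm_nonneg _))
          (h.weight_mul_norm_le hz)
      calc weight z ^ (l : ℕ) * ‖μ * h z + μ ^ 2 * kernelOp μ h z‖
          ≤ weight z ^ (l : ℕ) * (‖μ * h z‖ + ‖μ ^ 2 * kernelOp μ h z‖) :=
            mul_le_mul_of_nonneg_left (norm_add_le _ _) (pow_pos hw _).le
        _ = ‖μ‖ * (weight z ^ (l : ℕ) * ‖h z‖)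
            + ‖μ‖ ^ 2 * (weight z ^ (l : ℕ) * ‖kernelOp μ h z‖) := by
            rw [norm_mul, norm_mul, norm_pow]; ring
        _ ≤ ‖μ‖ * ‖h‖ + ‖μ‖ ^ 2 * (B * ‖h‖) :=
            add_le_add (mul_le_mul_of_nonneg_left h1 (norm_nonneg _))
              (mul_le_mul_of_nonneg_left (hB z hz) (sq_nonneg _))
        _ = _ := by ring
  exact ⟨g, VH.ext_disc fun z hz => (hg z hz).trans (hr z hz).symm, hM⟩

end LogGrowth

theorem theorem2p4 :
    ∃ T : LogGrowth.VH →L[ℂ] LogGrowth.VH,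
      -- `T` is the Cesàro operator
      (∀ f : LogGrowth.VH, ∀ z ∈ LogGrowth.disc, T f z = LogGrowth.cesaro f z) ∧
      -- (i) the point spectrum
      LogGrowth.pointSpectrum T = ∅ ∧
      -- (ii) the spectrum
      spectrum ℂ T = {0} ∪ {lam : ℂ | 0 < lam.re} ∧
      -- the semigroup law on functions on the disc, and contractivity on each step
      ((∀ t : ℝ, 0 ≤ t → Set.MapsTo (LogGrowth.phi t) LogGrowth.disc LogGrowth.disc) ∧
        (∀ f : ℂ → ℂ, ∀ z ∈ LogGrowth.disc, LogGrowth.semigroupOp 0 f z = f z) ∧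
        (∀ s t : ℝ, 0 ≤ s → 0 ≤ t → ∀ f : ℂ → ℂ, ∀ z ∈ LogGrowth.disc,
          LogGrowth.semigroupOp (s + t) f z
            = LogGrowth.semigroupOp s (LogGrowth.semigroupOp t f) z) ∧
        (∀ t : ℝ, 0 ≤ t → ∀ (k : ℕ+) (h : LogGrowth.Step k), ∃ g : LogGrowth.Step k,
          (∀ z ∈ LogGrowth.disc, g z = LogGrowth.semigroupOp t h z) ∧ ‖g‖ ≤ ‖h‖)) ∧
      -- the resolvent for `Re lam < 0`
      (∀ lam : ℂ, lam.re < 0 →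
        (∀ h : LogGrowth.VH, ∀ z ∈ LogGrowth.disc,
          MeasureTheory.IntegrableOn
            (fun t : ℝ => Complex.exp (t / lam) * LogGrowth.semigroupOp t h z) (Set.Ioi 0) ∧
          resolvent T lam h z = h z / lam + 1 / lam ^ 2 *
            ∫ t in Set.Ioi (0 : ℝ), Complex.exp (t / lam) * LogGrowth.semigroupOp t h z) ∧
        (∀ (k : ℕ+) (h : LogGrowth.Step k), ∃ g : LogGrowth.Step k,
          LogGrowth.VH.incl k g = resolvent T lam (LogGrowth.VH.incl k h) ∧
          ‖g‖ ≤ (1 / ‖lam‖ + 1 / |lam.re|) * ‖h‖)) ∧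
      -- the resolvent for `Re lam = 0`, `lam ≠ 0`
      (∀ lam : ℂ, lam.re = 0 → lam ≠ 0 →
        (∀ h : LogGrowth.VH, ∀ z ∈ LogGrowth.disc, z ∈ Complex.slitPlane →
          IntervalIntegrable (fun t : ℝ => LogGrowth.resolventIntegrand lam h (t * z))
            MeasureTheory.volume 0 1 ∧
          resolvent T lam h z = h z / lam + 1 / lam ^ 2 * z ^ (1 / lam - 1)
            * (1 - z) ^ (-1 / lam)
            * LogGrowth.segmentIntegral (LogGrowth.resolventIntegrand lam h) z) ∧
        (∃ C : ℝ, ∀ (k : ℕ+) (h : LogGrowth.Step k), ∃ g : LogGrowth.Step (k + 1),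
          LogGrowth.VH.incl (k + 1) g = resolvent T lam (LogGrowth.VH.incl k h) ∧
          ‖g‖ ≤ C * ‖h‖)) := by
  obtain ⟨T, hT⟩ := LogGrowth.VH.exists_operator (LogGrowth.kernelOp 0) (fun k => k + 1) _
    (fun f g z hz => LogGrowth.kernelOp_add (μ := 0) le_rfl f.differentiableOn g.differentiableOn hz)
    (fun c f z _ => LogGrowth.kernelOp_const_mul _ c f z)
    (fun f => LogGrowth.kernelOp_differentiableOn (μ := 0) le_rfl f.differentiableOn)
    (fun k h z hz => LogGrowth.weight_mul_kernelOp_le (μ := 0) rfl h hz)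
  have hneg : ∀ lam : ℂ, lam.re < 0 → _ := fun lam hlam =>
    LogGrowth.VH.isUnit_and_resolvent hT (lam := lam) (fun h0 => by simp [h0] at hlam)
      (LogGrowth.inv_re_neg hlam).le (fun k => k) (fun _ => |lam⁻¹.re|⁻¹)
      (fun k h z hz => LogGrowth.weight_mul_kernelOp_le_of_neg (LogGrowth.inv_re_neg hlam) h hz)
  have hzero : ∀ lam : ℂ, lam.re = 0 → lam ≠ 0 → _ := fun lam hlam h0 =>
    LogGrowth.VH.isUnit_and_resolvent hT h0 (LogGrowth.inv_re_eq_zero hlam).le (fun k => k + 1) _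
      (fun k h z hz => LogGrowth.weight_mul_kernelOp_le (LogGrowth.inv_re_eq_zero hlam) h hz)
  have happ : ∀ (lam : ℂ) (f : LogGrowth.VH), ∀ z ∈ LogGrowth.disc,
      (algebraMap ℂ (LogGrowth.VH →L[ℂ] LogGrowth.VH) lam - T) f z
        = lam * f z - LogGrowth.kernelOp 0 f z := fun lam f z hz => by
    rw [← hT f z hz]
    rfl
  -- An operator that misses some `g` has no inverse.
  have hnot : ∀ lam : ℂ, (∃ g : LogGrowth.VH, ∀ f : LogGrowth.VH,
      ¬ ∀ z ∈ LogGrowth.disc, lam * f z - LogGrowth.kernelOp 0 f z = g z) →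
      ¬ IsUnit (algebraMap ℂ (LogGrowth.VH →L[ℂ] LogGrowth.VH) lam - T) := by
    rintro lam ⟨g, hg⟩ ⟨U, hU⟩
    have hUg : (algebraMap ℂ (LogGrowth.VH →L[ℂ] LogGrowth.VH) lam - T)
        ((U⁻¹ : (LogGrowth.VH →L[ℂ] LogGrowth.VH)ˣ).val g) = g := by
      rw [← hU]
      exact congrArg (fun B : LogGrowth.VH →L[ℂ] LogGrowth.VH => B g) U.mul_inv
    exact hg _ fun z hz => by rw [← happ lam _ z hz, hUg]
  refine ⟨T, fun f z hz => (hT f z hz).trans (LogGrowth.cesaro_eq_kernelOp f z).symm, ?_, ?_,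
    ⟨fun t ht z hz => LogGrowth.phi_mem_disc ht hz, fun f z _ => LogGrowth.semigroupOp_zero f z,
      fun s t hs _ f z hz => LogGrowth.semigroupOp_add hs t f hz, fun t ht k h =>
      LogGrowth.Step.exists_of_bound (LogGrowth.semigroupOp_differentiableOn ht h.differentiableOn)
        fun z hz => LogGrowth.weight_mul_semigroupOp_le ht h hz⟩, ?_, ?_⟩
  · refine Set.eq_empty_of_forall_notMem fun lam hlam => hlam ?_
    refine (injective_iff_map_eq_zero _).2 fun f hf => f.eq_zero_of_eigen (lam := lam)
      fun z hz => ?_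
    rw [← happ lam f z hz]
    exact congrArg (fun g : LogGrowth.VH => g z) hf
  · ext lam
    rw [spectrum.mem_iff]
    simp only [Set.mem_union, Set.mem_singleton_iff, Set.mem_ofPred_eq]
    constructor
    · intro hlam
      by_contra! hcon
      rcases hcon.2.lt_or_eq with h | h
      · exact hlam (hneg lam h).1
      · exact hlam (hzero lam h hcon.1).1
    · rintro (rfl | hlam)
      · exact hnot 0 LogGrowth.exists_notMem_range_kernelOp_zero
      · exact hnot lam (LogGrowth.exists_notMem_range hlam)
  · intro lam hlam
    have hμ := LogGrowth.inv_re_neg hlam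
    refine ⟨fun h z hz => ?_, fun k h => ?_⟩
    · have e : ∀ t : ℝ, (t / lam : ℂ) = lam⁻¹ * t := fun t => div_eq_inv_mul _ _
      have hi := LogGrowth.kernelOp_eq_integral hμ.le h.differentiableOn hz
      simp only [e]
      refine ⟨hi.1, ?_⟩
      rw [(hneg lam hlam).2 h z hz, ← hi.2, div_eq_inv_mul, one_div, inv_pow]
    · obtain ⟨g, hg, hM⟩ := LogGrowth.exists_step_resolvent le_rfl hμ.le h
        (fun z hz => LogGrowth.weight_mul_kernelOp_le_of_neg hμ h hz)
        ((hneg lam hlam).2 (LogGrowth.VH.incl k h))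
      refine ⟨g, hg, hM.trans_eq ?_⟩
      rw [LogGrowth.sq_norm_mul_inv_abs_inv_re hlam, norm_inv, ← one_div ‖lam‖]
  · intro lam hlam h0
    have hμ := LogGrowth.inv_re_eq_zero hlam
    refine ⟨fun h z hz hslit => ?_, _, fun k h =>
      LogGrowth.exists_step_resolvent (PNat.lt_add_right k 1).le hμ.le h
        (fun z hz => LogGrowth.weight_mul_kernelOp_le hμ h hz)
        ((hzero lam hlam h0).2 (LogGrowth.VH.incl k h))⟩
    have hs := LogGrowth.kernelOp_eq_segmentIntegral hμ.le h.differentiableOn hz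
      (Complex.slitPlane_ne_zero hslit)
    refine ⟨hs.1, ?_⟩
    rw [(hzero lam hlam h0).2 h z hz, ← hs.2, div_eq_inv_mul, one_div, inv_pow]
    ring
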